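/- **Setting.** Let $E=(E^0,E^1,r,s)$ be a directed graph (an edge $e$ has source $s(e)$ and range $r(e)$) and $K$ a field. A vertex is *regular* if it emits at least one and only finitely many edges. The *Leavitt path algebra* $\mathcal L=L_K(E)$ is the free associative (not necessarily unital) $K$-algebra generated by $E^0\cup E^1\cup (E^1)^*$ subject to * (V) $vv'=\delta_{v,v'}v$ for $v,v'\in E^0$; * (E1) $s(e)e=er(e)=e$ for $e\in E^1$; * (E2) $r(e)e^*=e^*s(e)=e^*$ for $e\in E^1$; * (CK1) $e^*f=\delta_{e,f}r(e)$ for $e,f\in E^1$; * (CK2) $v=\sum_{e\in E^1,\,s(e)=v}ee^*$ for every regular vertex $v$. $\mathrm{Path}(E)$ is the set of all finite paths $p=e_1\cdots e_n$ ($r(e_i)=s(e_{i+1})$), including the vertices as paths of length $0$; $r(p)=r(e_n)$ and $p^*=e_n^*\cdots e_1^*$, while $r(v)=v$ and $v^*=v$ for a vertex $v$. A *cycle* is a path $e_1\cdots e_n$ with $n\ge 1$, $r(e_n)=s(e_1)$ and $s(e_i)\ne s(e_j)$ for $i\neq j$. The standard involution $\star$ of $\mathcal L$ is the $K$-linear anti-automorphism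 with $v^\star=v$, $e^\star=e^*$, $(e^*)^\star=e$. Put $\mathbf K_{\mathcal L}=\{x\in\mathcal L: x^\star=-x\}$ and let $[\mathcal L,\mathcal L]$ be the $K$-span of all $ab-ba$ with $a,b\in\mathcal L$. For $v\in E^0$ let $\epsilon_v$ be the standard basis vector of $\mathbb Z^{(E^0)}$ at $v$. If $v$ is regular, let $B_v=(a_{vu})_{u\in E^0}-\epsilon_v$, where $a_{vu}$ is the number of edges from $v$ to $u$; otherwise let $B_v=0$. The images of $\epsilon_v$ and $B_v$ in $K^{(E^0)}$ are denoted by the same symbols. **Corollary 3.7.** Suppose that $E$ contains no cycle. 1. If $\operatorname{char}K\ne 2$, then $\mathbf K_{\mathcal L}\cap[\mathcal L,\mathcal L]=\mathbf K_{\mathcal L}$. 2. If $\operatorname{char}K=2$, then for every $x\in\mathcal L$ we have $x\in\mathbf K_{\mathcal L}\cap[\mathcal L,\mathcal L]$ if and only if there are integers $k,l\ge 0$, scalars $a_1,\dots,a_k,b_1,\dots,b_l\in K$ and paths $p_1,\dots,p_k,q_1,\dots,q_l,t_1,\dots,t_l\in\mathrm{Path}(E)$ such that $$x=\sum_{i=1}^k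 a_ip_ip_i^*+\sum_{i=1}^l b_i\,(t_iq_i^*-q_it_i^*),\qquad \sum_{i=1}^k a_i\epsilon_{r(p_i)}\in\operatorname{span}_K\{B_v: v\in E^0\}\subseteq K^{(E^0)},$$ and $t_i\ne q_i$ for all $1\le i\le l$. -/

import Mathlib

universe u v w

noncomputable section

namespace Leavitt

/-! ### Directed graphs

A directed graph is a quiver `V`: the vertices are the elements of `V`, the edges are the arrows,
and an arrow `e : a ⟶ b` has source `s(e) = a` and range `r(e) = b`. The set of edges emitted by
`a` is `Quiver.Star a = Σ b, (a ⟶ b)`. -/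

section Graph

variable {V : Type u} [Quiver.{w} V]

/-- A vertex is regular if it is neither a sink nor an infinite emitter. -/
def IsRegular (a : V) : Prop :=
  Nonempty (Quiver.Star a) ∧ Finite (Quiver.Star a)

variable (V) in
/-- All edges of the graph, each bundled with its source and its range. -/
abbrev Edges : Type (max u w) := Σ a b : V, (a ⟶ b)

variable (V) in
/-- `Path(E)`: all finite paths `e₁ e₂ ⋯ eₙ` with `r(eᵢ) = s(eᵢ₊₁)`, bundled with source and range;
the vertices are the paths of length `0`. -/
abbrev FinPath : Type (max u w) := Σ a b : V, Quiver.Path a b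

/-- The range of a path. -/
def FinPath.range (p : FinPath V) : V := p.2.1

/-- The list `s(e₁), …, s(eₙ)` of the sources of the edges of a path `e₁ ⋯ eₙ`. -/
def sources {a : V} : ∀ {b : V}, Quiver.Path a b → List V
  | _, .nil => []
  | _, .cons (b := b) p _ => sources p ++ [b]

/-- A closed path `e₁ ⋯ eₙ` based at `a` is a cycle if `n ≥ 1` and `s(eᵢ) ≠ s(eⱼ)` for `i ≠ j`. -/
def IsCycle {a : V} (p : Quiver.Path a a) : Prop :=
  1 ≤ p.length ∧ (sources p).Nodup

variable (V) in
/-- The graph does not contain a cycle. -/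
def NoCycle : Prop :=
  ∀ (a : V) (p : Quiver.Path a a), ¬ IsCycle p

/-- The number `a_{au}` of edges from `a` to `u` is nonzero for only finitely many `u`, if `a` is
regular. -/
theorem finite_support_card {a : V} (h : IsRegular a) :
    (Function.support fun u : V => (Nat.card (a ⟶ u) : ℤ)).Finite := by
  have := h.2
  refine (Set.finite_range fun e : Quiver.Star a => e.1).subset fun u hu => ?_
  have h0 : Nat.card (a ⟶ u) ≠ 0 := by
    intro h0
    exact hu (by simp [h0])
  obtain ⟨⟨e⟩, _⟩ := Nat.card_ne_zero.mp h0
  exact ⟨⟨u, e⟩, rfl⟩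

open Classical in
/-- `B_a = (a_{au})_u - ε_a ∈ ℤ^(E⁰)` for a regular vertex `a`, where `a_{au}` is the number of
edges from `a` to `u`; and `B_a = 0` for a vertex `a` that is not regular. -/
def B (a : V) : V →₀ ℤ :=
  if h : IsRegular a then
    Finsupp.ofSupportFinite (fun u => (Nat.card (a ⟶ u) : ℤ)) (finite_support_card h)
      - Finsupp.single a 1
  else 0

/-- The subspace `span_K {B_a | a ∈ E⁰}` of `K^(E⁰)`, where `ℤ^(E⁰)` is mapped to `K^(E⁰)`
coordinatewise. -/
def spanB (K : Type v) [Field K] (V : Type u) [Quiver.{w} V] : Submodule K (V →₀ K) :=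
  Submodule.span K
    (Set.range fun a : V => (B a).mapRange (Int.cast : ℤ → K) Int.cast_zero)

end Graph

/-! ### The Leavitt path algebra -/

section Algebra

variable (K : Type v) [Field K] (V : Type u) [Quiver.{w} V]

/-- The generators of the Leavitt path algebra: vertices, edges, ghost edges `e*`. -/
inductive Gen : Type (max u w)
  | vertex (a : V) : Gen
  | edge (e : Edges V) : Gen
  | ghost (e : Edges V) : Gen

/-- The free associative (not necessarily unital) `K`-algebra on the generators: its `K`-basis
consists of all nonempty words in the generators. -/
abbrev FreeAlg : Type (max u v w) := MonoidAlgebra K (FreeSemigroup (Gen V))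

variable {V} in
/-- A generator as an element of the free algebra. -/
def gen (g : Gen V) : FreeAlg K V := MonoidAlgebra.single (FreeSemigroup.of g) 1

/-- The defining relations (V), (E1), (E2), (CK1), (CK2) of the Leavitt path algebra. -/
inductive Rel : FreeAlg K V → FreeAlg K V → Prop
  | v_same (a : V) : Rel (gen K (.vertex a) * gen K (.vertex a)) (gen K (.vertex a))
  | v_ne (a b : V) (h : a ≠ b) : Rel (gen K (.vertex a) * gen K (.vertex b)) 0
  | e1_source (e : Edges V) : Rel (gen K (.vertex e.1) * gen K (.edge e)) (gen K (.edge e))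
  | e1_range (e : Edges V) : Rel (gen K (.edge e) * gen K (.vertex e.2.1)) (gen K (.edge e))
  | e2_range (e : Edges V) : Rel (gen K (.vertex e.2.1) * gen K (.ghost e)) (gen K (.ghost e))
  | e2_source (e : Edges V) : Rel (gen K (.ghost e) * gen K (.vertex e.1)) (gen K (.ghost e))
  | ck1_same (e : Edges V) : Rel (gen K (.ghost e) * gen K (.edge e)) (gen K (.vertex e.2.1))
  | ck1_ne (e f : Edges V) (h : e ≠ f) : Rel (gen K (.ghost e) * gen K (.edge f)) 0
  | ck2 (a : V) (h : IsRegular a) :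
      Rel (gen K (.vertex a))
        (∑ᶠ e : Quiver.Star a, gen K (.edge ⟨a, e⟩) * gen K (.ghost ⟨a, e⟩))

/-- The congruence generated by the relations. All scalar multiples of the relations are put in, so
that it is a congruence of `K`-algebras (the free algebra need not contain the scalars). -/
def con : RingCon (FreeAlg K V) :=
  ringConGen fun x y => ∃ (c : K) (a b : FreeAlg K V), Rel K V a b ∧ x = c • a ∧ y = c • b

theorem con_smul (c : K) {x y : FreeAlg K V} (h : con K V x y) : con K V (c • x) (c • y) := by
  change RingConGen.Rel _ x y at h
  change RingConGen.Rel _ (c • x) (c • y)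
  induction h with
  | of x y h =>
    obtain ⟨d, a, b, h, rfl, rfl⟩ := h
    exact .of _ _ ⟨c * d, a, b, h, smul_smul _ _ _, smul_smul _ _ _⟩
  | refl x => exact .refl _
  | symm _ ih => exact .symm ih
  | trans _ _ ih₁ ih₂ => exact .trans ih₁ ih₂
  | add _ _ ih₁ ih₂ => simpa only [smul_add] using RingConGen.Rel.add ih₁ ih₂
  | mul _ h₂ ih₁ _ => simpa only [smul_mul_assoc] using RingConGen.Rel.mul ih₁ h₂

end Algebra

end Leavitt

/-- The Leavitt path algebra `L_K(E)` of the graph `E = V`: the free associative, not necessarily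
unital, `K`-algebra generated by the vertices, edges and ghost edges, modulo the relations (V),
(E1), (E2), (CK1), (CK2). -/
def LeavittPathAlgebra (K : Type v) [Field K] (V : Type u) [Quiver.{w} V] :
    Type (max u v w) :=
  (Leavitt.con K V).Quotient

namespace LeavittPathAlgebra

open Leavitt

section Structure

variable (K : Type v) [Field K] (V : Type u) [Quiver.{w} V]

instance : NonUnitalRing (LeavittPathAlgebra K V) :=
  inferInstanceAs (NonUnitalRing (con K V).Quotient)

variable {K V} in
/-- The quotient map from the free algebra. -/
def mk (x : FreeAlg K V) : LeavittPathAlgebra K V := RingCon.toQuotient x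

theorem mk_surjective : Function.Surjective (mk : FreeAlg K V → LeavittPathAlgebra K V) :=
  Quotient.mk''_surjective

instance : SMul K (LeavittPathAlgebra K V) where
  smul := (con K V).smulAux fun c _ _ h => con_smul K V c h

variable {K V}

theorem mk_add (x y : FreeAlg K V) : mk (x + y) = mk x + mk y := rfl
theorem mk_mul (x y : FreeAlg K V) : mk (x * y) = mk x * mk y := rfl
theorem mk_smul (c : K) (x : FreeAlg K V) : mk (c • x) = c • mk x := rfl
theorem mk_zero : mk (0 : FreeAlg K V) = 0 := rfl

instance : Module K (LeavittPathAlgebra K V) :=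
  Function.Surjective.module K
    (⟨⟨mk, mk_zero⟩, mk_add⟩ : FreeAlg K V →+ LeavittPathAlgebra K V) (mk_surjective K V) mk_smul

instance : IsScalarTower K (LeavittPathAlgebra K V) (LeavittPathAlgebra K V) where
  smul_assoc c x y := by
    obtain ⟨x, rfl⟩ := mk_surjective K V x
    obtain ⟨y, rfl⟩ := mk_surjective K V y
    simp only [smul_eq_mul, ← mk_smul, ← mk_mul, smul_mul_assoc]

instance : SMulCommClass K (LeavittPathAlgebra K V) (LeavittPathAlgebra K V) where
  smul_comm c x y := by
    obtain ⟨x, rfl⟩ := mk_surjective K V x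
    obtain ⟨y, rfl⟩ := mk_surjective K V y
    simp only [smul_eq_mul, ← mk_smul, ← mk_mul, mul_smul_comm]

variable (K V) in
/-- The quotient map as a homomorphism of (not necessarily unital) `K`-algebras. -/
def mkHom : FreeAlg K V →ₙₐ[K] LeavittPathAlgebra K V where
  toFun := mk
  map_smul' := mk_smul
  map_zero' := mk_zero
  map_add' := mk_add
  map_mul' := mk_mul

theorem mk_eq_of_rel {x y : FreeAlg K V} (h : Rel K V x y) : mk x = mk y :=
  (RingCon.eq _).2 (RingConGen.Rel.of _ _ ⟨1, x, y, h, (one_smul _ _).symm, (one_smul _ _).symm⟩)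

variable (K) in
/-- The vertex `a` as an element of the Leavitt path algebra. -/
def vertex (a : V) : LeavittPathAlgebra K V := mk (gen K (.vertex a))

variable (K) in
/-- The edge `e` as an element of the Leavitt path algebra. -/
def edge (e : Edges V) : LeavittPathAlgebra K V := mk (gen K (.edge e))

variable (K) in
/-- The ghost edge `e*` as an element of the Leavitt path algebra. -/
def ghost (e : Edges V) : LeavittPathAlgebra K V := mk (gen K (.ghost e))

variable (K) in
/-- A path `e₁ ⋯ eₙ` as an element of the Leavitt path algebra (a path of length `0` is the
vertex). -/
def pathAux {a : V} : ∀ {b : V}, Quiver.Path a b → LeavittPathAlgebra K V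
  | _, .nil => vertex K a
  | _, .cons p e => pathAux p * edge K ⟨_, _, e⟩

variable (K) in
/-- A path as an element of the Leavitt path algebra. -/
def path (p : FinPath V) : LeavittPathAlgebra K V := pathAux K p.2.2

variable (K) in
/-- The ghost path `(e₁ ⋯ eₙ)* = eₙ* ⋯ e₁*`; a vertex is its own ghost. -/
def ghostAux {a : V} : ∀ {b : V}, Quiver.Path a b → LeavittPathAlgebra K V
  | _, .nil => vertex K a
  | _, .cons p e => ghost K ⟨_, _, e⟩ * ghostAux p

variable (K) in
/-- The element `p*` of the Leavitt path algebra. -/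
def ghostPath (p : FinPath V) : LeavittPathAlgebra K V := ghostAux K p.2.2

end Structure

section Involution

variable {K : Type v} [Field K] {V : Type u} [Quiver.{w} V]
variable {A : Type*} [NonUnitalRing A] [Module K A] [IsScalarTower K A A] [SMulCommClass K A A]

/-- The homomorphism from the free algebra with given values on the generators. -/
def freeLift (f : Gen V → A) : FreeAlg K V →ₙₐ[K] A :=
  MonoidAlgebra.liftMagma K (FreeSemigroup.lift f)

theorem freeLift_gen (f : Gen V → A) (g : Gen V) : freeLift (K := K) f (gen K g) = f g := by
  simp [freeLift, gen]

theorem freeLift_eq_of_con (f : Gen V → A)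
    (hf : ∀ x y, Rel K V x y → freeLift f x = freeLift f y)
    {x y : FreeAlg K V} (h : con K V x y) : freeLift f x = freeLift f y := by
  change RingConGen.Rel _ x y at h
  induction h with
  | of x y h =>
    obtain ⟨d, a, b, h, rfl, rfl⟩ := h
    rw [map_smul, map_smul, hf _ _ h]
  | refl x => rfl
  | symm _ ih => exact ih.symm
  | trans _ _ ih₁ ih₂ => exact ih₁.trans ih₂
  | add _ _ ih₁ ih₂ => rw [map_add, map_add, ih₁, ih₂]
  | mul _ _ ih₁ ih₂ => rw [map_mul, map_mul, ih₁, ih₂]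

/-- The universal property of the Leavitt path algebra. -/
def lift (f : Gen V → A) (hf : ∀ x y, Rel K V x y → freeLift f x = freeLift f y) :
    LeavittPathAlgebra K V →ₙₐ[K] A where
  toFun x := Quotient.liftOn' x (freeLift f) fun _ _ h => freeLift_eq_of_con f hf h
  map_smul' c x := by
    obtain ⟨x, rfl⟩ := mk_surjective K V x
    exact map_smul (freeLift f) c x
  map_zero' := map_zero (freeLift (K := K) f)
  map_add' x y := by
    obtain ⟨x, rfl⟩ := mk_surjective K V x
    obtain ⟨y, rfl⟩ := mk_surjective K V y
    exact map_add (freeLift f) x y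
  map_mul' x y := by
    obtain ⟨x, rfl⟩ := mk_surjective K V x
    obtain ⟨y, rfl⟩ := mk_surjective K V y
    exact map_mul (freeLift f) x y

theorem lift_mk_gen (f : Gen V → A) (hf : ∀ x y, Rel K V x y → freeLift f x = freeLift f y)
    (g : Gen V) : lift f hf (mk (gen K g)) = f g :=
  freeLift_gen f g

theorem hom_ext {f g : LeavittPathAlgebra K V →ₙₐ[K] A}
    (h : ∀ x : Gen V, f (mk (gen K x)) = g (mk (gen K x))) : f = g := by
  have h' : f.comp (mkHom K V) = g.comp (mkHom K V) := by
    apply (MonoidAlgebra.liftMagma K).symm.injective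
    apply FreeSemigroup.hom_ext
    funext x
    exact h x
  ext x
  obtain ⟨x, rfl⟩ := mk_surjective K V x
  exact DFunLike.congr_fun h' x

/-- Values of the standard involution on the generators: `v ↦ v`, `e ↦ e*`, `e* ↦ e`. -/
def starGen : Gen V → (LeavittPathAlgebra K V)ᵐᵒᵖ
  | .vertex a => .op (vertex K a)
  | .edge e => .op (ghost K e)
  | .ghost e => .op (edge K e)

theorem starGen_rel (x y : FreeAlg K V) (h : Rel K V x y) :
    freeLift (starGen (K := K)) x = freeLift (starGen (K := K)) y := by
  induction h with
  | v_same a =>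
    simp only [map_mul, freeLift_gen, starGen, ← MulOpposite.op_mul]
    exact congrArg _ (mk_eq_of_rel (.v_same a))
  | v_ne a b h =>
    simp only [map_mul, freeLift_gen, starGen, ← MulOpposite.op_mul, map_zero]
    exact congrArg MulOpposite.op (mk_eq_of_rel (.v_ne b a h.symm))
  | e1_source e =>
    simp only [map_mul, freeLift_gen, starGen, ← MulOpposite.op_mul]
    exact congrArg _ (mk_eq_of_rel (.e2_source e))
  | e1_range e =>
    simp only [map_mul, freeLift_gen, starGen, ← MulOpposite.op_mul]
    exact congrArg _ (mk_eq_of_rel (.e2_range e))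
  | e2_range e =>
    simp only [map_mul, freeLift_gen, starGen, ← MulOpposite.op_mul]
    exact congrArg _ (mk_eq_of_rel (.e1_range e))
  | e2_source e =>
    simp only [map_mul, freeLift_gen, starGen, ← MulOpposite.op_mul]
    exact congrArg _ (mk_eq_of_rel (.e1_source e))
  | ck1_same e =>
    simp only [map_mul, freeLift_gen, starGen, ← MulOpposite.op_mul]
    exact congrArg _ (mk_eq_of_rel (.ck1_same e))
  | ck1_ne e f h =>
    simp only [map_mul, freeLift_gen, starGen, ← MulOpposite.op_mul, map_zero]
    exact congrArg MulOpposite.op (mk_eq_of_rel (.ck1_ne f e h.symm))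
  | ck2 a h =>
    have := h.2
    have key : mk (gen K (.vertex a)) = mk _ := mk_eq_of_rel (.ck2 a h)
    have := Fintype.ofFinite (Quiver.Star a)
    rw [finsum_eq_sum_of_fintype] at key ⊢
    rw [map_sum]
    simp only [map_mul, freeLift_gen, starGen, ← MulOpposite.op_mul]
    rw [← Finset.op_sum]
    refine congrArg MulOpposite.op (key.trans ?_)
    exact map_sum (mkHom K V) _ _

/-- The standard involution as an anti-homomorphism of `K`-algebras. -/
def starHom : LeavittPathAlgebra K V →ₙₐ[K] (LeavittPathAlgebra K V)ᵐᵒᵖ :=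
  lift (starGen (K := K)) starGen_rel

theorem unop_starHom_unop_starHom (x : LeavittPathAlgebra K V) :
    (starHom (starHom x).unop).unop = x := by
  let φ : LeavittPathAlgebra K V →ₙₐ[K] LeavittPathAlgebra K V :=
    { toFun := fun x => (starHom (starHom x).unop).unop
      map_smul' := fun c x => by simp
      map_zero' := by simp
      map_add' := fun x y => by simp
      map_mul' := fun x y => by simp }
  have : φ = NonUnitalAlgHom.id K (LeavittPathAlgebra K V) := by
    apply hom_ext
    rintro (a | e | e)
    · change (starHom (starHom (mk (gen K _))).unop).unop = mk (gen K _)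
      rw [starHom, lift_mk_gen]
      exact congrArg MulOpposite.unop (lift_mk_gen starGen starGen_rel _)
    · change (starHom (starHom (mk (gen K _))).unop).unop = mk (gen K _)
      rw [starHom, lift_mk_gen]
      exact congrArg MulOpposite.unop (lift_mk_gen starGen starGen_rel _)
    · change (starHom (starHom (mk (gen K _))).unop).unop = mk (gen K _)
      rw [starHom, lift_mk_gen]
      exact congrArg MulOpposite.unop (lift_mk_gen starGen starGen_rel _)
  exact DFunLike.congr_fun this x

/-- The standard involution of the Leavitt path algebra: it is `K`-linear, reverses products, fixes
the vertices and interchanges `e` and `e*` for every edge `e`. -/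
instance : StarRing (LeavittPathAlgebra K V) where
  star x := (starHom x).unop
  star_involutive := unop_starHom_unop_starHom
  star_mul x y := by simp
  star_add x y := by simp

theorem star_smul_eq (c : K) (x : LeavittPathAlgebra K V) : star (c • x) = c • star x := by
  change (starHom (c • x)).unop = c • (starHom x).unop
  simp

theorem star_vertex (a : V) : star (vertex K a) = vertex K a :=
  congrArg MulOpposite.unop (lift_mk_gen starGen starGen_rel _)

theorem star_edge (e : Edges V) : star (edge K e) = ghost K e :=
  congrArg MulOpposite.unop (lift_mk_gen starGen starGen_rel _)

theorem star_ghost (e : Edges V) : star (ghost K e) = edge K e :=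
  congrArg MulOpposite.unop (lift_mk_gen starGen starGen_rel _)

theorem star_path (p : FinPath V) : star (path K p) = ghostPath K p := by
  obtain ⟨a, b, p⟩ := p
  change star (pathAux K p) = ghostAux K p
  induction p with
  | nil => exact star_vertex a
  | cons p e ih => rw [pathAux, ghostAux, star_mul, star_edge, ih]

end Involution

section Subspaces

variable (K : Type v) [Field K] (V : Type u) [Quiver.{w} V]

/-- The set `𝐊_L = {x ∈ L | x⋆ = -x}` of skew-symmetric elements. -/
def skewElements : Set (LeavittPathAlgebra K V) := {x | star x = -x}

/-- The `K`-subspace `[L, L]` spanned by all commutators `ab - ba`. -/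
def commutators : Submodule K (LeavittPathAlgebra K V) :=
  Submodule.span K {x | ∃ a b : LeavittPathAlgebra K V, x = a * b - b * a}

end Subspaces

end LeavittPathAlgebra

end

/-! By (CK2) and the other relations, the algebra is spanned by the monomials `l m*`, where `l` and
`m` are paths with the same range. If there is no cycle, every monomial with `l ≠ m` is a sum of
commutators: strip common initial edges via `[e y, e*]`, and use that a nonempty path ending at `c`
cannot start at `c` (`monomial_mem_commutators`). Hence `x - x⋆` always lies in `[L, L]`. For skew
`x` this difference is `2x`, which settles characteristic different from 2.

In characteristic 2, skew means symmetric. For the direction from the combination to `[L, L]`, note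
that `p p* - r(p) = [p, p*]`, and that (CK2) makes the image of `B_v` equal to the sum of the
commutators `[e*, e]` over the edges `e` emitted by `v`.

The converse needs two things. First, a symmetric element must have an expansion with symmetric
coefficients, although the monomials are linearly dependent and averaging over the involution is
impossible. Choosing one special edge at each regular vertex and eliminating the words in which both
paths end with it gives a normal form that commutes with the involution (`swapWord_normalCoords`).
Off-diagonal terms then pair up as `l m* + m l* = l m* - m l*`. Secondly, the diagonal coefficients
must satisfy the span condition. For this, `p p* ↦ r(p)`, `p q* ↦ 0` for `p ≠ q`, is shown to be a
well-defined trace with values in `K^(E⁰)` modulo the `B_v`; it vanishes on commutators.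

Both the normal form and the trace are linear maps out of an algebra given by generators and
relations. To construct them, the algebra is made to act on formal words modulo (CK2). Letting `x`
act on a formal unit gives `toWords`, so any linear map on words that respects (CK2) induces one on
the algebra. -/

namespace Leavitt

/-! ### Paths as lists of edges -/

section Walks

variable {V : Type u} [Quiver.{w} V]

/-- The list of edges `l` is a path from `a` to `c`. -/
def IsWalk (a : V) : List (Edges V) → V → Prop
  | [], c => a = c
  | e :: l, c => e.1 = a ∧ IsWalk e.2.1 l c

theorem IsWalk.source_unique {a b c : V} {l : List (Edges V)} (h : IsWalk a l c)
    (h' : IsWalk b l c) : a = b := by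
  cases l with
  | nil => exact h.trans h'.symm
  | cons e l => exact h.1.symm.trans h'.1

theorem isWalk_append {a c : V} {l l' : List (Edges V)} :
    IsWalk a (l ++ l') c ↔ ∃ b, IsWalk a l b ∧ IsWalk b l' c := by
  induction l generalizing a with
  | nil => simp [IsWalk]
  | cons e l ih => simp [IsWalk, ih, and_assoc]

theorem isWalk_concat {a c : V} {l : List (Edges V)} {e : Edges V} (he : e.1 = c) :
    IsWalk a (l ++ [e]) e.2.1 ↔ IsWalk a l c := by
  simp [isWalk_append, IsWalk, he]

open Classical in
/-- The finite set of edges emitted by a regular vertex. -/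
noncomputable def outEdges (a : V) : Finset (Edges V) :=
  if h : {e : Edges V | e.1 = a}.Finite then h.toFinset else ∅

theorem mem_outEdges {a : V} (h : IsRegular a) {e : Edges V} : e ∈ outEdges a ↔ e.1 = a := by
  have := h.2
  have hf : {e : Edges V | e.1 = a}.Finite := by
    refine (Set.finite_range fun e : Quiver.Star a => (⟨a, e⟩ : Edges V)).subset ?_
    rintro ⟨b, e⟩ rfl
    exact ⟨e, rfl⟩
  simp [outEdges, hf]

theorem finsum_star_eq {M : Type*} [AddCommMonoid M] {a : V} (h : IsRegular a)
    (F : Edges V → M) : ∑ᶠ e : Quiver.Star a, F ⟨a, e⟩ = ∑ e ∈ outEdges a, F e := by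
  have := h.2
  have := Fintype.ofFinite (Quiver.Star a)
  rw [finsum_eq_sum_of_fintype]
  refine Finset.sum_bij (fun e _ => (⟨a, e⟩ : Edges V)) ?_ ?_ ?_ ?_
  · intro e _
    exact (mem_outEdges h).2 rfl
  · intro e _ f _ hef
    simpa using hef
  · rintro ⟨b, e⟩ hb
    obtain rfl := (mem_outEdges h).1 hb
    exact ⟨e, Finset.mem_univ _, rfl⟩
  · intros
    rfl

theorem exists_mem_outEdges {a : V} (h : IsRegular a) : ∃ e : Edges V, e.1 = a :=
  h.1.elim fun e => ⟨⟨a, e⟩, rfl⟩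

end Walks

/-! ### The action of the generators on words modulo (CK2) -/

section Representation

variable (K : Type v) [Field K] (V : Type u) [Quiver.{w} V]

/-- A triple `(c, l, m)` stands for the monomial `l m*`, where `l` and `m` are lists of edges
that end at `c`. -/
abbrev Word : Type (max u w) := V × List (Edges V) × List (Edges V)

/-- The space with basis all words and a formal unit `none`. -/
abbrev WordSpace : Type (max u v w) := Option (Word V) →₀ K

variable {V} in
/-- The basis vector of a word. -/
noncomputable def word (c : V) (l m : List (Edges V)) : WordSpace K V :=
  Finsupp.single (some (c, l, m)) 1

variable {K V} in
theorem wordSpace_hom_ext {M : Type*} [AddCommGroup M] [Module K M] {f g : WordSpace K V →ₗ[K] M}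
    (h₀ : f (Finsupp.single none 1) = g (Finsupp.single none 1))
    (h : ∀ c l m, f (word K c l m) = g (word K c l m)) : f = g := by
  apply Finsupp.lhom_ext'
  rintro (_ | ⟨c, l, m⟩)
  · exact LinearMap.ext_ring h₀
  · exact LinearMap.ext_ring (h c l m)

open Classical in
variable {V} in
/-- Left multiplication by a generator on basis vectors. -/
noncomputable def genActOn : Gen V → Option (Word V) → WordSpace K V
  | .vertex a, none => word K a [] []
  | .vertex a, some (c, l, m) => if IsWalk a l c then word K c l m else 0
  | .edge e, none => word K e.2.1 [e] []
  | .edge e, some (c, l, m) => if IsWalk e.2.1 l c then word K c (e :: l) m else 0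
  | .ghost e, none => word K e.2.1 [] [e]
  | .ghost e, some (c, [], m) => if e.1 = c then word K e.2.1 [] (m ++ [e]) else 0
  | .ghost e, some (c, f :: l, m) =>
      if e = f ∧ IsWalk e.2.1 l c then word K c l m else 0

variable {V} in
/-- Left multiplication by a generator. -/
noncomputable def genAct (g : Gen V) : WordSpace K V →ₗ[K] WordSpace K V :=
  Finsupp.lsum K fun i => LinearMap.toSpanSingleton K _ (genActOn K g i)

section

variable {V}

theorem genAct_none (g : Gen V) : genAct K g (Finsupp.single none 1) = genActOn K g none := by
  simp [genAct]

theorem genAct_word (g : Gen V) (c : V) (l m : List (Edges V)) :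
    genAct K g (word K c l m) = genActOn K g (some (c, l, m)) := by
  simp [genAct, word]

/-- The difference of the two sides of the relation (CK2) inserted in the middle of a word. -/
noncomputable def ckDiff (c : V) (l m : List (Edges V)) : WordSpace K V :=
  word K c l m - ∑ e ∈ outEdges c, word K e.2.1 (l ++ [e]) (m ++ [e])

end

/-- The subspace spanned by the relations (CK2). -/
noncomputable def ckSpace : Submodule K (WordSpace K V) :=
  Submodule.span K {w | ∃ (c : V) (l m : List (Edges V)), IsRegular c ∧ w = ckDiff K c l m}

variable {K V}

theorem ckDiff_mem {c : V} (h : IsRegular c) (l m : List (Edges V)) :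
    ckDiff K c l m ∈ ckSpace K V :=
  Submodule.subset_span ⟨c, l, m, h, rfl⟩

theorem ckSpace_le_ker {M : Type*} [AddCommGroup M] [Module K M] (f : WordSpace K V →ₗ[K] M)
    (h : ∀ (c : V) (l m : List (Edges V)), IsRegular c →
      f (word K c l m) = ∑ e ∈ outEdges c, f (word K e.2.1 (l ++ [e]) (m ++ [e]))) :
    ckSpace K V ≤ LinearMap.ker f := by
  refine Submodule.span_le.2 ?_
  rintro _ ⟨c, l, m, hc, rfl⟩
  simp [ckDiff, h c l m hc]

/-- A generator acts at the left end of a word, while (CK2) is inserted in the middle; the walk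
conditions do not change when an edge from `c` is appended. Thus the image of a (CK2) difference is
again such a difference or zero. Only a ghost edge meeting an empty `l` reaches the middle. -/
theorem ckSpace_le_comap (g : Gen V) : ckSpace K V ≤ (ckSpace K V).comap (genAct K g) := by
  classical
  refine Submodule.span_le.2 ?_
  rintro _ ⟨c, l, m, hc, rfl⟩
  change genAct K g (ckDiff K c l m) ∈ ckSpace K V
  simp only [ckDiff, map_sub, map_sum, genAct_word]
  cases g with
  | vertex a =>
    have : ∀ e ∈ outEdges c, genActOn K (.vertex a) (some (e.2.1, l ++ [e], m ++ [e])) =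
        if IsWalk a l c then word K e.2.1 (l ++ [e]) (m ++ [e]) else 0 := fun e he => by
      simp only [genActOn, isWalk_concat ((mem_outEdges hc).1 he)]
    rw [Finset.sum_congr rfl this]
    by_cases h : IsWalk a l c
    · simpa [genActOn, h, ckDiff] using ckDiff_mem hc l m
    · simp [genActOn, h]
  | edge f =>
    have : ∀ e ∈ outEdges c, genActOn K (.edge f) (some (e.2.1, l ++ [e], m ++ [e])) =
        if IsWalk f.2.1 l c then word K e.2.1 (f :: l ++ [e]) (m ++ [e]) else 0 := fun e he => by
      simp only [genActOn, isWalk_concat ((mem_outEdges hc).1 he), List.cons_append]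
    rw [Finset.sum_congr rfl this]
    by_cases h : IsWalk f.2.1 l c
    · simpa [genActOn, h, ckDiff] using ckDiff_mem hc (f :: l) m
    · simp [genActOn, h]
  | ghost f =>
    cases l with
    | nil =>
      -- By (CK1) only the summand `e = f` survives, and it equals the word obtained by applying
      -- `f*` before the expansion. The image of the difference is therefore zero.
      have : ∀ e ∈ outEdges c, genActOn K (.ghost f) (some (e.2.1, [] ++ [e], m ++ [e])) =
          if f = e then word K f.2.1 [] (m ++ [f]) else 0 := fun e he => by
        by_cases h : f = e
        · subst h
          simp [genActOn, IsWalk]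
        · simp [genActOn, h]
      rw [Finset.sum_congr rfl this]
      simp [genActOn, mem_outEdges hc]
    | cons f' l =>
      have : ∀ e ∈ outEdges c, genActOn K (.ghost f) (some (e.2.1, f' :: l ++ [e], m ++ [e])) =
          if f = f' ∧ IsWalk f.2.1 l c then word K e.2.1 (l ++ [e]) (m ++ [e]) else 0 :=
        fun e he => by
          simp only [genActOn, List.cons_append, isWalk_concat ((mem_outEdges hc).1 he)]
      rw [Finset.sum_congr rfl this]
      by_cases h : f = f' ∧ IsWalk f.2.1 l c
      · simpa [genActOn, h, ckDiff] using ckDiff_mem hc l m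
      · simp only [genActOn, h]
        simp

/-- The action of a generator on the quotient by the relations (CK2). -/
noncomputable def genEnd (g : Gen V) : Module.End K (WordSpace K V ⧸ ckSpace K V) :=
  (ckSpace K V).mapQ (ckSpace K V) (genAct K g) (ckSpace_le_comap g)

theorem genEnd_mk (g : Gen V) (w : WordSpace K V) :
    genEnd g ((ckSpace K V).mkQ w) = (ckSpace K V).mkQ (genAct K g w) := rfl

theorem genEnd_rel (x y : FreeAlg K V) (h : Rel K V x y) :
    LeavittPathAlgebra.freeLift (genEnd (K := K)) x =
      LeavittPathAlgebra.freeLift (genEnd (K := K)) y := by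
  classical
  -- All relations except (CK2) hold already on words, before passing to the quotient.
  have key : ∀ (g h k : Gen V), (genAct K g ∘ₗ genAct K h = genAct K k) →
      genEnd (K := K) g * genEnd h = genEnd k := fun g h k H => by
    apply Submodule.linearMap_qext
    refine LinearMap.ext fun w => ?_
    simp only [LinearMap.comp_apply, Module.End.mul_apply, genEnd_mk, ← H]
  have key0 : ∀ (g h : Gen V), (genAct K g ∘ₗ genAct K h = 0) →
      genEnd (K := K) g * genEnd h = 0 := fun g h H => by
    apply Submodule.linearMap_qext
    refine LinearMap.ext fun w => ?_
    simp only [LinearMap.comp_apply, Module.End.mul_apply, genEnd_mk]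
    rw [← LinearMap.comp_apply (genAct K g), H]
    simp
  induction h with
  | v_same a =>
    simp only [map_mul, LeavittPathAlgebra.freeLift_gen]
    refine key _ _ _ (wordSpace_hom_ext ?_ fun c l m => ?_)
    · simp [genAct_none, genAct_word, genActOn, IsWalk]
    · by_cases h : IsWalk a l c <;> simp [genAct_word, genActOn, h]
  | v_ne a b h =>
    simp only [map_mul, LeavittPathAlgebra.freeLift_gen, map_zero]
    refine key0 _ _ (wordSpace_hom_ext ?_ fun c l m => ?_)
    · simp [genAct_none, genAct_word, genActOn, IsWalk, h]
    · by_cases h' : IsWalk b l c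
      · have : ¬ IsWalk a l c := fun H => h (H.source_unique h')
        simp [genAct_word, genActOn, h', this]
      · simp [genAct_word, genActOn, h']
  | e1_source e =>
    simp only [map_mul, LeavittPathAlgebra.freeLift_gen]
    refine key _ _ _ (wordSpace_hom_ext ?_ fun c l m => ?_)
    · simp [genAct_none, genAct_word, genActOn, IsWalk]
    · by_cases h : IsWalk e.2.1 l c <;> simp [genAct_word, genActOn, h, IsWalk]
  | e1_range e =>
    simp only [map_mul, LeavittPathAlgebra.freeLift_gen]
    refine key _ _ _ (wordSpace_hom_ext ?_ fun c l m => ?_)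
    · simp [genAct_none, genAct_word, genActOn, IsWalk]
    · by_cases h : IsWalk e.2.1 l c <;> simp [genAct_word, genActOn, h]
  | e2_range e =>
    simp only [map_mul, LeavittPathAlgebra.freeLift_gen]
    refine key _ _ _ (wordSpace_hom_ext ?_ fun c l m => ?_)
    · simp [genAct_none, genAct_word, genActOn, IsWalk]
    · cases l with
      | nil => by_cases h : e.1 = c <;> simp [genAct_word, genActOn, h, IsWalk]
      | cons f l =>
        by_cases h : e = f ∧ IsWalk e.2.1 l c
        · simp [genAct_word, genActOn, h, h.1 ▸ h.2]
        · simp only [LinearMap.comp_apply, genAct_word, genActOn, if_neg h, map_zero]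
  | e2_source e =>
    simp only [map_mul, LeavittPathAlgebra.freeLift_gen]
    refine key _ _ _ (wordSpace_hom_ext ?_ fun c l m => ?_)
    · simp [genAct_none, genAct_word, genActOn]
    · cases l with
      | nil => by_cases h : e.1 = c <;> simp [genAct_word, genActOn, h, IsWalk]
      | cons f l =>
        by_cases h : e = f ∧ IsWalk e.2.1 l c
        · obtain ⟨rfl, h⟩ := h
          simp [genAct_word, genActOn, h, IsWalk]
        · by_cases h' : IsWalk e.1 (f :: l) c
          · simp only [LinearMap.comp_apply, genAct_word, genActOn, if_neg h, if_pos h']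
          · simp only [LinearMap.comp_apply, genAct_word, genActOn, if_neg h, if_neg h', map_zero]
  | ck1_same e =>
    simp only [map_mul, LeavittPathAlgebra.freeLift_gen]
    refine key _ _ _ (wordSpace_hom_ext ?_ fun c l m => ?_)
    · simp [genAct_none, genAct_word, genActOn, IsWalk]
    · by_cases h : IsWalk e.2.1 l c <;> simp [genAct_word, genActOn, h]
  | ck1_ne e f h =>
    simp only [map_mul, LeavittPathAlgebra.freeLift_gen, map_zero]
    refine key0 _ _ (wordSpace_hom_ext ?_ fun c l m => ?_)
    · simp [genAct_none, genAct_word, genActOn, h]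
    · by_cases h' : IsWalk f.2.1 l c <;> simp [genAct_word, genActOn, h', h]
  | ck2 a ha =>
    rw [finsum_star_eq ha fun e => gen K (.edge e) * gen K (.ghost e), map_sum]
    simp only [map_mul, LeavittPathAlgebra.freeLift_gen]
    apply Submodule.linearMap_qext
    have hsum : (∑ e ∈ outEdges a, genEnd (K := K) (.edge e) * genEnd (.ghost e)) ∘ₗ
        (ckSpace K V).mkQ = (ckSpace K V).mkQ ∘ₗ
          ∑ e ∈ outEdges a, genAct K (.edge e) ∘ₗ genAct K (.ghost e) := by
      refine LinearMap.ext fun w => ?_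
      simp only [LinearMap.comp_apply, LinearMap.sum_apply, Module.End.mul_apply, genEnd_mk,
        map_sum]
    rw [hsum]
    -- The quotient is needed only for the unit and for words with empty `l`. If `l` starts with
    -- `f`, the sum of the `e e*` reduces to the term `e = f` and (CK2) holds exactly.
    have hdiff : ∀ m, (ckSpace K V).mkQ (word K a [] m) =
        (ckSpace K V).mkQ (∑ e ∈ outEdges a, word K e.2.1 [e] (m ++ [e])) := fun m => by
      rw [← sub_eq_zero, ← map_sub]
      exact (Submodule.Quotient.mk_eq_zero _).2 (ckDiff_mem ha [] m)
    refine wordSpace_hom_ext ?_ fun c l m => ?_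
    · simp only [LinearMap.comp_apply, genEnd_mk, LinearMap.sum_apply, genAct_none, genAct_word,
        genActOn, IsWalk, if_true]
      exact hdiff []
    · simp only [LinearMap.comp_apply, genEnd_mk, LinearMap.sum_apply, genAct_word]
      cases l with
      | nil =>
        by_cases hac : a = c
        · subst hac
          simp only [genActOn, IsWalk, if_true]
          rw [hdiff]
          congr 1
          refine Finset.sum_congr rfl fun e he => ?_
          rw [if_pos ((mem_outEdges ha).1 he), genAct_word]
          simp [genActOn, IsWalk]
        · have hw : ¬ IsWalk a [] c := hac
          simp only [genActOn]
          rw [if_neg hw, Finset.sum_eq_zero]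
          intro e he
          rw [if_neg fun h => hac (((mem_outEdges ha).1 he).symm.trans h), map_zero]
      | cons f l =>
        congr 1
        have : ∀ e ∈ outEdges a, genAct K (.edge e) (genActOn K (.ghost e) (some (c, f :: l, m)))
            = if e = f then (if IsWalk f.2.1 l c then word K c (f :: l) m else 0) else 0 :=
          fun e he => by
            by_cases h : e = f
            · subst h
              by_cases h' : IsWalk e.2.1 l c <;> simp [genAct_word, genActOn, h']
            · simp [genActOn, h]
        rw [Finset.sum_congr rfl this, Finset.sum_ite_eq']
        by_cases h₁ : f.1 = a <;> by_cases h₂ : IsWalk f.2.1 l c <;>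
          simp [mem_outEdges ha, genActOn, IsWalk, h₁, h₂]

end Representation

end Leavitt

/-! ### Monomials, and the comparison of the algebra with words -/

namespace LeavittPathAlgebra

open Leavitt

variable {K : Type v} [Field K] {V : Type u} [Quiver.{w} V]

theorem induction_gen {p : LeavittPathAlgebra K V → Prop} (gen : ∀ g, p (mk (gen K g)))
    (add : ∀ x y, p x → p y → p (x + y)) (smul : ∀ (c : K) x, p x → p (c • x))
    (mul : ∀ x y, p x → p y → p (x * y)) (zero : p 0) (x : LeavittPathAlgebra K V) : p x := by
  have hs : ∀ s : FreeSemigroup (Gen V), p (mk (MonoidAlgebra.single s (1 : K))) := by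
    intro s
    induction s using FreeSemigroup.recOnMul with
    | ih1 g => exact gen g
    | ih2 g s h₁ h₂ =>
      have := mul _ _ (gen g) h₂
      rwa [← mk_mul, Leavitt.gen, MonoidAlgebra.single_mul_single, one_mul] at this
  obtain ⟨y, rfl⟩ := mk_surjective K V x
  induction y using MonoidAlgebra.induction_linear with
  | zero => exact zero
  | add y z hy hz => exact add _ _ hy hz
  | single s c =>
    have := smul c _ (hs s)
    rwa [← mk_smul, MonoidAlgebra.smul_single, smul_eq_mul, mul_one] at this

theorem vertex_mul_vertex_same (a : V) : vertex K a * vertex K a = vertex K a :=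
  mk_eq_of_rel (.v_same a)

theorem vertex_mul_vertex_ne {a b : V} (h : a ≠ b) : vertex K a * vertex K b = 0 :=
  mk_eq_of_rel (.v_ne a b h)

theorem vertex_mul_edge (e : Edges V) : vertex K e.1 * edge K e = edge K e :=
  mk_eq_of_rel (.e1_source e)

theorem edge_mul_vertex (e : Edges V) : edge K e * vertex K e.2.1 = edge K e :=
  mk_eq_of_rel (.e1_range e)

theorem vertex_mul_ghost (e : Edges V) : vertex K e.2.1 * ghost K e = ghost K e :=
  mk_eq_of_rel (.e2_range e)

theorem ghost_mul_vertex (e : Edges V) : ghost K e * vertex K e.1 = ghost K e :=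
  mk_eq_of_rel (.e2_source e)

theorem ghost_mul_edge_same (e : Edges V) : ghost K e * edge K e = vertex K e.2.1 :=
  mk_eq_of_rel (.ck1_same e)

theorem ghost_mul_edge_ne {e f : Edges V} (h : e ≠ f) : ghost K e * edge K f = 0 :=
  mk_eq_of_rel (.ck1_ne e f h)

theorem vertex_eq_sum {a : V} (h : IsRegular a) :
    vertex K a = ∑ e ∈ outEdges a, edge K e * ghost K e := by
  have key : mk (gen K (.vertex a)) = mk _ := mk_eq_of_rel (.ck2 a h)
  rw [finsum_star_eq h fun e => gen K (.edge e) * gen K (.ghost e)] at key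
  exact key.trans (map_sum (mkHom K V) _ _)

variable (K) in
/-- The product of a list of edges and the vertex `c`. -/
noncomputable def walkElt (c : V) (l : List (Edges V)) : LeavittPathAlgebra K V :=
  l.foldr (fun e x => edge K e * x) (vertex K c)

theorem walkElt_nil (c : V) : walkElt K c [] = vertex K c := rfl

theorem walkElt_cons (c : V) (e : Edges V) (l : List (Edges V)) :
    walkElt K c (e :: l) = edge K e * walkElt K c l := rfl

open Classical in
theorem vertex_mul_walkElt (a c : V) (l : List (Edges V)) :
    vertex K a * walkElt K c l = if IsWalk a l c then walkElt K c l else 0 := by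
  induction l generalizing a with
  | nil =>
    by_cases h : a = c
    · subst h
      simp [walkElt_nil, IsWalk, vertex_mul_vertex_same]
    · simp [walkElt_nil, IsWalk, h, vertex_mul_vertex_ne h]
  | cons e l ih =>
    rw [walkElt_cons]
    by_cases h : a = e.1
    · subst h
      rw [← mul_assoc, vertex_mul_edge]
      simp only [IsWalk, true_and]
      split_ifs with h'
      · rfl
      · rw [← edge_mul_vertex, mul_assoc, ih, if_neg h', mul_zero]
    · rw [← mul_assoc, ← vertex_mul_edge, ← mul_assoc, vertex_mul_vertex_ne h, zero_mul, zero_mul,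
        if_neg fun h' => h h'.1.symm]

open Classical in
theorem edge_mul_walkElt (e : Edges V) (c : V) (l : List (Edges V)) :
    edge K e * walkElt K c l = if IsWalk e.2.1 l c then walkElt K c (e :: l) else 0 := by
  rw [← edge_mul_vertex, mul_assoc, vertex_mul_walkElt]
  split_ifs
  · rfl
  · rw [mul_zero]

open Classical in
theorem ghost_mul_walkElt (e f : Edges V) (c : V) (l : List (Edges V)) :
    ghost K e * walkElt K c (f :: l) =
      if e = f ∧ IsWalk e.2.1 l c then walkElt K c l else 0 := by
  rw [walkElt_cons, ← mul_assoc]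
  by_cases h : e = f
  · subst h
    simp [ghost_mul_edge_same, vertex_mul_walkElt]
  · simp [ghost_mul_edge_ne h, h]

theorem walkElt_mul_vertex (c : V) (l : List (Edges V)) :
    walkElt K c l * vertex K c = walkElt K c l := by
  induction l with
  | nil => exact vertex_mul_vertex_same c
  | cons e l ih => rw [walkElt_cons, mul_assoc, ih]

theorem walkElt_concat {c : V} {e : Edges V} (he : e.1 = c) (l : List (Edges V)) :
    walkElt K e.2.1 (l ++ [e]) = walkElt K c l * edge K e := by
  subst he
  induction l with
  | nil => simp [walkElt, edge_mul_vertex, vertex_mul_edge]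
  | cons f l ih => rw [List.cons_append, walkElt_cons, ih, walkElt_cons, mul_assoc]

theorem walkElt_eq_zero {c : V} {l : List (Edges V)} (h : ¬ ∃ a, IsWalk a l c) :
    walkElt K c l = 0 := by
  classical
  cases l with
  | nil => exact absurd ⟨c, rfl⟩ h
  | cons e l =>
    rw [walkElt_cons, edge_mul_walkElt, if_neg fun h' => h ⟨_, rfl, h'⟩]

variable (K) in
/-- The monomial `l m*`. -/
noncomputable def monomial (c : V) (l m : List (Edges V)) : LeavittPathAlgebra K V :=
  walkElt K c l * star (walkElt K c m)

theorem star_monomial (c : V) (l m : List (Edges V)) :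
    star (monomial K c l m) = monomial K c m l := by
  simp [monomial]

theorem monomial_eq_zero {c : V} {l m : List (Edges V)}
    (h : ¬ ((∃ a, IsWalk a l c) ∧ ∃ a, IsWalk a m c)) : monomial K c l m = 0 := by
  rw [monomial]
  by_cases hl : ∃ a, IsWalk a l c
  · rw [walkElt_eq_zero fun hm => h ⟨hl, hm⟩, star_zero, mul_zero]
  · rw [walkElt_eq_zero hl, zero_mul]

theorem monomial_eq_sum {c : V} (h : IsRegular c) (l m : List (Edges V)) :
    monomial K c l m = ∑ e ∈ outEdges c, monomial K e.2.1 (l ++ [e]) (m ++ [e]) := by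
  rw [monomial, ← walkElt_mul_vertex c l, vertex_eq_sum h, Finset.mul_sum, Finset.sum_mul]
  refine Finset.sum_congr rfl fun e he => ?_
  have he := (mem_outEdges h).1 he
  rw [monomial, walkElt_concat he, walkElt_concat he, star_mul, star_edge]
  simp only [mul_assoc]

variable (K V) in
/-- The linear map that sends each word to the corresponding monomial, with values in the
unitization of the Leavitt path algebra. -/
noncomputable def evalWord : WordSpace K V →ₗ[K] Unitization K (LeavittPathAlgebra K V) :=
  Finsupp.lsum K fun i => LinearMap.toSpanSingleton K _ <|
    match i with
    | none => 1
    | some (c, l, m) => Unitization.inr (monomial K c l m)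

theorem evalWord_none : evalWord K V (Finsupp.single none 1) = 1 := by
  simp [evalWord]

theorem evalWord_word (c : V) (l m : List (Edges V)) :
    evalWord K V (word K c l m) = Unitization.inr (monomial K c l m) := by
  simp [evalWord, word]

theorem ckSpace_le_ker_evalWord : ckSpace K V ≤ LinearMap.ker (evalWord K V) := by
  refine ckSpace_le_ker _ fun c l m hc => ?_
  simp only [evalWord_word, monomial_eq_sum hc l m]
  exact map_sum (Unitization.inrHom K K (LeavittPathAlgebra K V)) _ _

/-- The action on words was modelled on multiplication of monomials, so evaluation intertwines the
two. It follows that `evalQuot` recovers `x` from `toWords x`. -/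
theorem evalWord_genAct (g : Gen V) (w : WordSpace K V) :
    evalWord K V (genAct K g w) = Unitization.inr (mk (gen K g)) * evalWord K V w := by
  classical
  suffices h : evalWord K V ∘ₗ genAct K g =
      LinearMap.mulLeft K (Unitization.inr (mk (gen K g))) ∘ₗ evalWord K V from
    LinearMap.congr_fun h w
  apply wordSpace_hom_ext
  · simp only [LinearMap.comp_apply, evalWord_none, genAct_none, LinearMap.mulLeft_apply, mul_one]
    cases g with
    | vertex a =>
      simp only [genActOn, evalWord_word, monomial, walkElt_nil, star_vertex,
        vertex_mul_vertex_same]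
      rfl
    | edge e =>
      simp only [genActOn, evalWord_word, monomial, walkElt_nil, walkElt_cons, star_vertex,
        edge_mul_vertex]
      rfl
    | ghost e =>
      simp only [genActOn, evalWord_word, monomial, walkElt_nil, walkElt_cons,
        edge_mul_vertex, star_edge, vertex_mul_ghost]
      rfl
  · intro c l m
    simp only [LinearMap.comp_apply, evalWord_word, genAct_word, LinearMap.mulLeft_apply,
      ← Unitization.inr_mul]
    have hif : ∀ (p : Prop) [Decidable p] (a : WordSpace K V),
        evalWord K V (if p then a else 0) = if p then evalWord K V a else 0 := fun p _ a => by
      split_ifs <;> simp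
    have hmul : ∀ (p : Prop) [Decidable p] (a b : LeavittPathAlgebra K V),
        (if p then a else 0) * b = if p then a * b else 0 := fun p _ a b => by
      split_ifs <;> simp
    have hinr : ∀ (p : Prop) [Decidable p] (a : LeavittPathAlgebra K V),
        (Unitization.inr (if p then a else 0) : Unitization K (LeavittPathAlgebra K V)) =
          if p then Unitization.inr a else 0 := fun p _ a => by
      split_ifs <;> simp
    cases g with
    | vertex a =>
      change _ = Unitization.inr (vertex K a * _)
      rw [monomial, ← mul_assoc, vertex_mul_walkElt, hmul, hinr, genActOn, hif, evalWord_word,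
        monomial]
    | edge e =>
      change _ = Unitization.inr (edge K e * _)
      rw [monomial, ← mul_assoc, edge_mul_walkElt, hmul, hinr, genActOn, hif, evalWord_word,
        monomial]
    | ghost e =>
      change _ = Unitization.inr (ghost K e * _)
      cases l with
      | cons f l =>
        rw [monomial, ← mul_assoc, ghost_mul_walkElt, hmul, hinr, genActOn, hif, evalWord_word,
          monomial]
      | nil =>
        rw [genActOn, hif, evalWord_word]
        by_cases h : e.1 = c
        · rw [if_pos h, monomial, walkElt_concat h, monomial, star_mul, star_edge, walkElt_nil,
            walkElt_nil, ← mul_assoc, vertex_mul_ghost, ← mul_assoc, ← h, ghost_mul_vertex]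
        · rw [if_neg h, monomial, ← mul_assoc, walkElt_nil, ← ghost_mul_vertex, mul_assoc (ghost K e),
            vertex_mul_vertex_ne h, mul_zero, zero_mul, Unitization.inr_zero]

/-- The representation of the Leavitt path algebra on words modulo (CK2). -/
noncomputable def wordRep : LeavittPathAlgebra K V →ₙₐ[K] Module.End K (WordSpace K V ⧸ ckSpace K V) :=
  lift genEnd genEnd_rel

theorem wordRep_gen (g : Gen V) (w : WordSpace K V) :
    wordRep (mk (gen K g)) ((ckSpace K V).mkQ w) = (ckSpace K V).mkQ (genAct K g w) := by
  rw [wordRep, lift_mk_gen, genEnd_mk]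

/-- The expression of an element as a combination of words modulo (CK2). -/
noncomputable def toWords : LeavittPathAlgebra K V →ₗ[K] WordSpace K V ⧸ ckSpace K V where
  toFun x := wordRep x ((ckSpace K V).mkQ (Finsupp.single none 1))
  map_add' x y := by simp
  map_smul' c x := by simp

theorem toWords_mul (x y : LeavittPathAlgebra K V) : toWords (x * y) = wordRep x (toWords y) := by
  change wordRep (x * y) _ = wordRep x (wordRep y _)
  rw [map_mul, Module.End.mul_apply]

/-- `evalWord` on the quotient. -/
noncomputable def evalQuot : (WordSpace K V ⧸ ckSpace K V) →ₗ[K] Unitization K (LeavittPathAlgebra K V) :=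
  (ckSpace K V).liftQ (evalWord K V) ckSpace_le_ker_evalWord

theorem evalQuot_wordRep (x : LeavittPathAlgebra K V) (q : WordSpace K V ⧸ ckSpace K V) :
    evalQuot (wordRep x q) = Unitization.inr x * evalQuot q := by
  induction x using induction_gen generalizing q with
  | gen g =>
    obtain ⟨w, rfl⟩ := (ckSpace K V).mkQ_surjective q
    rw [wordRep_gen]
    exact evalWord_genAct g w
  | add x y hx hy => simp [hx, hy, add_mul]
  | smul c x hx => simp [hx]
  | mul x y hx hy => simp [hx, hy, mul_assoc]
  | zero => simp

theorem evalQuot_toWords (x : LeavittPathAlgebra K V) :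
    evalQuot (toWords x) = Unitization.inr x := by
  change evalQuot (wordRep x _) = _
  rw [evalQuot_wordRep]
  change _ * evalWord K V _ = _
  rw [evalWord_none, mul_one]

theorem snd_evalWord (w : WordSpace K V) :
    (evalWord K V w).snd = w.sum fun i a => a • match i with
      | none => 0
      | some (c, l, m) => monomial K c l m := by
  rw [evalWord, Finsupp.lsum_apply, Finsupp.sum, Finsupp.sum]
  change (Unitization.sndHom K K _) _ = _
  rw [map_sum]
  refine Finset.sum_congr rfl ?_
  rintro (_ | ⟨c, l, m⟩) _ <;> simp

/-- Evaluating any representative of `toWords x` gives back `x`; words that are not pairs of paths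
evaluate to zero. -/
theorem mem_span_monomial (x : LeavittPathAlgebra K V) :
    x ∈ Submodule.span K {y | ∃ (c : V) (l m : List (Edges V)), (∃ a, IsWalk a l c) ∧
      (∃ a, IsWalk a m c) ∧ y = monomial K c l m} := by
  obtain ⟨w, hw⟩ := (ckSpace K V).mkQ_surjective (toWords x)
  have hx : (evalWord K V w).snd = x := by
    have := evalQuot_toWords x
    rw [← hw] at this
    exact congrArg (fun y => y.snd) this
  rw [← hx, snd_evalWord]
  refine Submodule.sum_mem _ ?_
  rintro (_ | ⟨c, l, m⟩) _
  · simp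
  · refine Submodule.smul_mem _ _ ?_
    by_cases h : (∃ a, IsWalk a l c) ∧ ∃ a, IsWalk a m c
    · exact Submodule.subset_span ⟨c, l, m, h.1, h.2, rfl⟩
    · change monomial K c l m ∈ _
      rw [monomial_eq_zero h]
      exact Submodule.zero_mem _

theorem wordRep_walkElt {a c : V} {l : List (Edges V)} (h : IsWalk a l c) (m : List (Edges V)) :
    wordRep (walkElt K c l) ((ckSpace K V).mkQ (word K c [] m)) =
      (ckSpace K V).mkQ (word K c l m) := by
  induction l generalizing a with
  | nil =>
    rw [walkElt_nil, vertex, wordRep_gen, genAct_word]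
    simp [genActOn, IsWalk]
  | cons e l ih =>
    rw [walkElt_cons, map_mul, Module.End.mul_apply, ih h.2, edge, wordRep_gen, genAct_word]
    simp [genActOn, h.2]

theorem wordRep_star_walkElt {a c : V} {m : List (Edges V)} (h : IsWalk a m c)
    (k : List (Edges V)) :
    wordRep (star (walkElt K c m)) ((ckSpace K V).mkQ (word K a [] k)) =
      (ckSpace K V).mkQ (word K c [] (k ++ m)) := by
  induction m generalizing a k with
  | nil =>
    obtain rfl : a = c := h
    rw [walkElt_nil, star_vertex, vertex, wordRep_gen, genAct_word]
    simp [genActOn, IsWalk]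
  | cons e m ih =>
    rw [walkElt_cons, star_mul, star_edge, map_mul, Module.End.mul_apply, ghost, wordRep_gen,
      genAct_word, genActOn, if_pos h.1, ih h.2, List.append_assoc, List.singleton_append]

theorem toWords_star_walkElt {a c : V} {m : List (Edges V)} (h : IsWalk a m c) :
    toWords (star (walkElt K c m)) = (ckSpace K V).mkQ (word K c [] m) := by
  change wordRep _ _ = _
  cases m with
  | nil =>
    rw [walkElt_nil, star_vertex, vertex, wordRep_gen, genAct_none]
    rfl
  | cons e m =>
    rw [walkElt_cons, star_mul, star_edge, map_mul, Module.End.mul_apply, ghost, wordRep_gen,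
      genAct_none, genActOn, wordRep_star_walkElt h.2, List.singleton_append]

/-- The ghost part acts first and turns the unit into the word with empty `l`; the edges of `l` are
then put in front. This computes the induced maps on the spanning monomials. -/
theorem toWords_monomial {a b c : V} {l m : List (Edges V)} (hl : IsWalk a l c)
    (hm : IsWalk b m c) :
    toWords (monomial K c l m) = (ckSpace K V).mkQ (word K c l m) := by
  rw [monomial, toWords_mul, toWords_star_walkElt hm, wordRep_walkElt hl]

end LeavittPathAlgebra

namespace Leavitt

/-! ### Paths versus lists of edges, and acyclicity -/

section Paths

variable {V : Type u} [Quiver.{w} V]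

/-- The list of edges of a path. -/
def edgeList {a : V} : ∀ {b : V}, Quiver.Path a b → List (Edges V)
  | _, .nil => []
  | _, .cons p e => edgeList p ++ [⟨_, _, e⟩]

theorem exists_edgeList_eq {a c : V} {l : List (Edges V)} (h : IsWalk a l c) :
    ∃ p : Quiver.Path a c, edgeList p = l := by
  induction l using List.reverseRecOn generalizing c with
  | nil =>
    obtain rfl : a = c := h
    exact ⟨.nil, rfl⟩
  | append_singleton l e ih =>
    obtain ⟨b, hl, rfl, rfl⟩ := isWalk_append.1 h
    obtain ⟨p, rfl⟩ := ih hl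
    exact ⟨p.cons e.2.2, rfl⟩

/-- The ranges must be compared separately, because the empty list does not remember its vertex. -/
theorem edgeList_injective {a b a' b' : V} {p : Quiver.Path a b} {q : Quiver.Path a' b'}
    (hb : b = b') (h : edgeList p = edgeList q) :
    (⟨a, b, p⟩ : FinPath V) = ⟨a', b', q⟩ := by
  induction p generalizing b' with
  | nil =>
    cases q with
    | nil => subst hb; rfl
    | cons q f => simp [edgeList] at h
  | cons p e ih =>
    cases q with
    | nil => simp [edgeList] at h
    | cons q f =>
      obtain ⟨h₁, h₂⟩ := List.append_inj' h rfl
      simp only [List.cons.injEq, and_true] at h₂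
      cases h₂
      cases ih rfl h₁
      rfl

theorem sources_eq_map {a b : V} (p : Quiver.Path a b) :
    sources p = (edgeList p).map Sigma.fst := by
  induction p with
  | nil => rfl
  | cons p e ih => simp [sources, edgeList, ih]

theorem length_eq_length_edgeList {a b : V} (p : Quiver.Path a b) :
    p.length = (edgeList p).length := by
  induction p with
  | nil => rfl
  | cons p e ih => simp [edgeList, ih]

/-- The segment between two visits to the same source is closed, and it is shorter because it omits
the edge leaving at the second visit. -/
theorem exists_closed_of_not_nodup {a c : V} {l : List (Edges V)} (h : IsWalk a l c)
    (hl : ¬ (l.map Sigma.fst).Nodup) :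
    ∃ (b : V) (k : List (Edges V)), IsWalk b k b ∧ k ≠ [] ∧ k.length < l.length := by
  induction l generalizing a with
  | nil => simp at hl
  | cons e l ih =>
    by_cases hmem : e.1 ∈ l.map Sigma.fst
    · obtain ⟨f, hf, hfe⟩ := List.mem_map.1 hmem
      obtain ⟨l₁, l₂, rfl⟩ := List.append_of_mem hf
      obtain ⟨b, h₁, h₂⟩ := isWalk_append.1 h.2
      refine ⟨e.1, e :: l₁, ⟨rfl, ?_⟩, by simp, by simp⟩
      rwa [h₂.1.symm.trans hfe] at h₁
    · have : ¬ (l.map Sigma.fst).Nodup := fun H => hl (by simpa using ⟨by simpa using hmem, H⟩)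
      obtain ⟨b, k, hk, hk₀, hlt⟩ := ih h.2 this
      exact ⟨b, k, hk, hk₀, hlt.trans (by simp)⟩

/-- A shortest nonempty closed path would have no repeated source, hence would be a cycle. -/
theorem NoCycle.eq_nil (hE : NoCycle V) {a : V} {l : List (Edges V)} (h : IsWalk a l a) :
    l = [] := by
  induction hn : l.length using Nat.strong_induction_on generalizing a l with
  | _ n ih =>
    subst hn
    by_contra hl
    by_cases hnd : (l.map Sigma.fst).Nodup
    · obtain ⟨p, rfl⟩ := exists_edgeList_eq h
      refine hE a p ⟨?_, ?_⟩
      · rw [length_eq_length_edgeList]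
        exact List.length_pos_iff.2 hl
      · rwa [sources_eq_map]
    · obtain ⟨b, k, hk, hk₀, hlt⟩ := exists_closed_of_not_nodup h hnd
      exact hk₀ (ih _ hlt hk rfl)

end Paths

/-! ### The trace on words -/

section Trace

variable (K : Type v) [Field K] {V : Type u} [Quiver.{w} V]

theorem mapRange_B {c : V} (h : IsRegular c) :
    (B c).mapRange (Int.cast : ℤ → K) Int.cast_zero =
      (∑ e ∈ outEdges c, Finsupp.single e.2.1 1) - Finsupp.single c 1 := by
  classical
  ext u
  have hcard : Nat.card (c ⟶ u) = ((outEdges c).filter fun e => e.2.1 = u).card := by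
    rw [← Fintype.card_coe, ← Nat.card_eq_fintype_card]
    let f : (c ⟶ u) → {e // e ∈ (outEdges c).filter fun e => e.2.1 = u} := fun g =>
      ⟨⟨c, u, g⟩, Finset.mem_filter.2 ⟨(mem_outEdges h).2 rfl, rfl⟩⟩
    refine Nat.card_eq_of_bijective f ⟨fun g g' hg => ?_, ?_⟩
    · simpa [f] using hg
    · rintro ⟨⟨a, b, g⟩, hg⟩
      obtain ⟨ha, hb⟩ := Finset.mem_filter.1 hg
      obtain rfl : a = c := (mem_outEdges h).1 ha
      obtain rfl : b = u := hb
      exact ⟨g, rfl⟩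
  simp only [B, dif_pos h, Finsupp.mapRange_apply, Finsupp.sub_apply, Finsupp.ofSupportFinite_coe,
    Finsupp.finsetSum_apply, Finsupp.single_apply, hcard, Finset.sum_boole, Int.cast_sub,
    Int.cast_natCast]
  congr 1
  split_ifs <;> simp

theorem mkQ_single_eq_sum {c : V} (h : IsRegular c) :
    (spanB K V).mkQ (Finsupp.single c 1) =
      ∑ e ∈ outEdges c, (spanB K V).mkQ (Finsupp.single e.2.1 1) := by
  rw [← map_sum, eq_comm, ← sub_eq_zero, ← map_sub, ← mapRange_B K h]
  exact (Submodule.Quotient.mk_eq_zero _).2 (Submodule.subset_span ⟨c, rfl⟩)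

open Classical in
variable (V) in
/-- The linear map that sends a word `l l*` to the range of `l` and all other words to `0`. -/
noncomputable def diagRange : WordSpace K V →ₗ[K] V →₀ K :=
  Finsupp.lsum K fun i => LinearMap.toSpanSingleton K _ <|
    match i with
    | none => 0
    | some (c, l, m) => if l = m ∧ ∃ a, IsWalk a l c then Finsupp.single c 1 else 0

open Classical in
theorem diagRange_word (c : V) (l m : List (Edges V)) : diagRange K V (word K c l m) =
    if l = m ∧ ∃ a, IsWalk a l c then Finsupp.single c 1 else 0 := by
  simp [diagRange, word]

/-- Appending the same edge to both paths preserves being diagonal, so (CK2) only replaces `ε_c` by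
the sum of the `ε_{r(e)}`; the two differ by `B_c`. -/
theorem ckSpace_le_ker_diagRange :
    ckSpace K V ≤ LinearMap.ker ((spanB K V).mkQ ∘ₗ diagRange K V) := by
  classical
  refine ckSpace_le_ker _ fun c l m hc => ?_
  simp only [LinearMap.comp_apply, diagRange_word]
  have : ∀ e ∈ outEdges c, (l ++ [e] = m ++ [e] ∧ ∃ a, IsWalk a (l ++ [e]) e.2.1) ↔
      (l = m ∧ ∃ a, IsWalk a l c) := fun e he => by
    simp only [isWalk_concat ((mem_outEdges hc).1 he), List.append_left_inj]
  rw [Finset.sum_congr rfl fun e he => by rw [if_congr (this e he) rfl rfl]]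
  by_cases h : l = m ∧ ∃ a, IsWalk a l c
  · simp only [if_pos h]
    exact mkQ_single_eq_sum K hc
  · simp only [if_neg h, map_zero, Finset.sum_const_zero]

/-- The generator `g*`. -/
def Gen.adjoint : Gen V → Gen V
  | .vertex a => .vertex a
  | .edge e => .ghost e
  | .ghost e => .edge e

/-- This is the trace property for one generator: by the involution, right multiplication of `l m*`
by `g` corresponds to left multiplication of `m l*` by `g*`. The point is that `e l = f m` exactly
when `e = f` and `l = m`. -/
theorem diagRange_genAct (g : Gen V) (c : V) (l m : List (Edges V)) :
    diagRange K V (genAct K g (word K c l m)) =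
      diagRange K V (genAct K g.adjoint (word K c m l)) := by
  classical
  have hif : ∀ (p : Prop) [Decidable p] (a : WordSpace K V),
      diagRange K V (if p then a else 0) = if p then diagRange K V a else 0 := fun p _ a => by
    split_ifs <;> simp
  have hedge : ∀ (e : Edges V) (l m : List (Edges V)),
      diagRange K V (genAct K (.edge e) (word K c l m)) =
        diagRange K V (genAct K (.ghost e) (word K c m l)) := fun e l m => by
    cases m with
    | nil => simp [genAct_word, genActOn, hif, diagRange_word]
    | cons f m =>
      simp only [genAct_word, genActOn, hif, diagRange_word]
      by_cases h : e = f ∧ l = m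
      · obtain ⟨rfl, rfl⟩ := h
        by_cases h' : IsWalk e.2.1 l c
        · have h₁ : ∃ a, IsWalk a (e :: l) c := ⟨_, rfl, h'⟩
          have h₂ : ∃ a, IsWalk a l c := ⟨_, h'⟩
          simp [h', h₁, h₂]
        · simp [h']
      · have h₁ : ¬ (e :: l = f :: m) := by simpa using h
        by_cases he : e = f
        · have h₂ : ¬ m = l := fun H => h ⟨he, H.symm⟩
          simp [h₁, h₂]
        · simp [h₁, he]
  cases g with
  | vertex a =>
    simp only [Gen.adjoint, genAct_word, genActOn, hif, diagRange_word]
    by_cases h : l = m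
    · subst h; rfl
    · simp [h, Ne.symm h]
  | edge e => exact hedge e l m
  | ghost e => exact (hedge e m l).symm

end Trace

/-! ### A normal form of words, compatible with the involution -/

section NormalForm

variable (K : Type v) [Field K] {V : Type u} [Quiver.{w} V]

/-- One edge is chosen among those emitted by each regular vertex. -/
def IsSpecial (e : Edges V) : Prop :=
  ∃ h : IsRegular e.1, e = (exists_mem_outEdges h).choose

theorem exists_isSpecial {a : V} (h : IsRegular a) : ∃ e : Edges V, e.1 = a ∧ IsSpecial e := by
  have he := (exists_mem_outEdges h).choose_spec
  generalize hc : (exists_mem_outEdges h).choose = e at he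
  subst he
  exact ⟨e, rfl, h, hc.symm⟩

theorem IsSpecial.eq {e f : Edges V} (he : IsSpecial e) (hf : IsSpecial f) (h : e.1 = f.1) :
    e = f := by
  obtain ⟨h₁, he⟩ := he
  obtain ⟨h₂, hf⟩ := hf
  rw [he, hf]
  congr 1
  simp only [h]

open Classical in
/-- The normal form of a word in which the two lists of edges are reversed: if both lists end with
the same special edge, this edge is eliminated by means of (CK2). -/
noncomputable def normalRev : V → List (Edges V) → List (Edges V) → WordSpace K V
  | c, e :: l, f :: m =>
      if e = f ∧ e.2.1 = c ∧ IsSpecial e then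
        normalRev e.1 l m -
          ∑ g ∈ (outEdges e.1).erase e, word K g.2.1 (l.reverse ++ [g]) (m.reverse ++ [g])
      else word K c (e :: l).reverse (f :: m).reverse
  | c, [], m => word K c [] m.reverse
  | c, l, [] => word K c l.reverse []

theorem mkQ_normalRev (c : V) (l m : List (Edges V)) :
    (ckSpace K V).mkQ (normalRev K c l m) = (ckSpace K V).mkQ (word K c l.reverse m.reverse) := by
  classical
  induction l generalizing c m with
  | nil => simp [normalRev]
  | cons e l ih =>
    cases m with
    | nil => simp [normalRev]
    | cons f m =>
      rw [normalRev]
      split_ifs with h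
      · obtain ⟨rfl, rfl, h⟩ := h
        rw [map_sub, ih, sub_eq_iff_eq_add, ← map_add, List.reverse_cons, List.reverse_cons,
          Finset.add_sum_erase (outEdges e.1)
            (fun g : Edges V => word K g.2.1 (l.reverse ++ [g]) (m.reverse ++ [g]))
            ((mem_outEdges h.1).2 rfl), ← sub_eq_zero, ← map_sub]
        exact (Submodule.Quotient.mk_eq_zero _).2 (ckDiff_mem h.1 _ _)
      · rfl

variable (V) in
/-- The normal form as a linear map. -/
noncomputable def normalForm : WordSpace K V →ₗ[K] WordSpace K V :=
  Finsupp.lsum K fun i => LinearMap.toSpanSingleton K _ <|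
    match i with
    | none => Finsupp.single none 1
    | some (c, l, m) => normalRev K c l.reverse m.reverse

theorem normalForm_none : normalForm K V (Finsupp.single none 1) = Finsupp.single none 1 := by
  simp [normalForm]

theorem normalForm_word (c : V) (l m : List (Edges V)) :
    normalForm K V (word K c l m) = normalRev K c l.reverse m.reverse := by
  simp [normalForm, word]

theorem mkQ_normalForm (w : WordSpace K V) :
    (ckSpace K V).mkQ (normalForm K V w) = (ckSpace K V).mkQ w := by
  suffices h : (ckSpace K V).mkQ ∘ₗ normalForm K V = (ckSpace K V).mkQ from
    LinearMap.congr_fun h w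
  refine wordSpace_hom_ext ?_ fun c l m => ?_
  · rw [LinearMap.comp_apply, normalForm_none]
  · rw [LinearMap.comp_apply, normalForm_word, mkQ_normalRev, List.reverse_reverse,
      List.reverse_reverse]

/-- In the expansion at `c`, only the summand with the special edge is rewritten: the others end
with non-special edges and are already normal. The rewriting subtracts precisely those others. -/
theorem ckSpace_le_ker_normalForm : ckSpace K V ≤ LinearMap.ker (normalForm K V) := by
  classical
  refine ckSpace_le_ker _ fun c l m hc => ?_
  obtain ⟨e, rfl, he⟩ := exists_isSpecial hc
  have hmem : e ∈ outEdges e.1 := (mem_outEdges hc).2 rfl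
  rw [← Finset.add_sum_erase _ _ hmem, normalForm_word, normalForm_word]
  have : ∀ f ∈ (outEdges e.1).erase e,
      normalForm K V (word K f.2.1 (l ++ [f]) (m ++ [f])) = word K f.2.1 (l ++ [f]) (m ++ [f]) :=
    fun f hf => by
      obtain ⟨hne, hf⟩ := Finset.mem_erase.1 hf
      have hsp : ¬ IsSpecial f := fun h => hne (h.eq he ((mem_outEdges hc).1 hf))
      simp [normalForm_word, normalRev, hsp]
  rw [Finset.sum_congr rfl this]
  simp [normalRev, he]

variable (V) in
/-- The linear map induced by the involution of words. -/
noncomputable def swapWord : WordSpace K V →ₗ[K] WordSpace K V :=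
  Finsupp.lmapDomain K K (Option.map fun i : Word V => (i.1, i.2.2, i.2.1))

theorem swapWord_word (c : V) (l m : List (Edges V)) :
    swapWord K V (word K c l m) = word K c m l := by
  simp [swapWord, word, Finsupp.mapDomain_single]

theorem swapWord_apply (w : WordSpace K V) (c : V) (l m : List (Edges V)) :
    swapWord K V w (some (c, l, m)) = w (some (c, m, l)) := by
  have hinj : Function.Injective (Option.map fun i : Word V => (i.1, i.2.2, i.2.1)) := by
    apply Option.map_injective
    rintro ⟨a, b, c⟩ ⟨a', b', c'⟩ h
    simp only [Prod.mk.injEq] at h ⊢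
    tauto
  exact Finsupp.mapDomain_apply hinj w (some (c, m, l))

/-- The elimination rule treats the two lists alike. -/
theorem swapWord_normalRev (c : V) (l m : List (Edges V)) :
    swapWord K V (normalRev K c l m) = normalRev K c m l := by
  classical
  induction l generalizing c m with
  | nil => cases m <;> simp [normalRev, swapWord_word]
  | cons e l ih =>
    cases m with
    | nil => simp [normalRev, swapWord_word]
    | cons f m =>
      by_cases h : e = f ∧ e.2.1 = c ∧ IsSpecial e
      · obtain ⟨rfl, h⟩ := h
        simp [normalRev, h, swapWord_word, ih]
      · have h' : ¬ (f = e ∧ f.2.1 = c ∧ IsSpecial f) := by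
          rintro ⟨rfl, H⟩
          exact h ⟨rfl, H⟩
        rw [normalRev, normalRev, if_neg h, if_neg h', swapWord_word]

end NormalForm

end Leavitt

/-! ### The trace and the normal coordinates on the algebra -/

namespace LeavittPathAlgebra

open Leavitt

variable {K : Type v} [Field K] {V : Type u} [Quiver.{w} V]

/-- The trace of the Leavitt path algebra that sends `p q*` to the class of `r(p)` if `p = q`, and
to `0` if `p ≠ q`. -/
noncomputable def trace : LeavittPathAlgebra K V →ₗ[K] (V →₀ K) ⧸ spanB K V :=
  (ckSpace K V).liftQ _ (ckSpace_le_ker_diagRange K) ∘ₗ toWords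

theorem trace_eq {x : LeavittPathAlgebra K V} {w : WordSpace K V}
    (h : toWords x = (ckSpace K V).mkQ w) : trace x = (spanB K V).mkQ (diagRange K V w) := by
  rw [trace, LinearMap.comp_apply, h]
  rfl

theorem linearMap_ext_monomial {M : Type*} [AddCommGroup M] [Module K M]
    {f g : LeavittPathAlgebra K V →ₗ[K] M}
    (h : ∀ (c : V) (l m : List (Edges V)), (∃ a, IsWalk a l c) → (∃ a, IsWalk a m c) →
      f (monomial K c l m) = g (monomial K c l m)) : f = g := by
  ext x
  induction mem_span_monomial x using Submodule.span_induction with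
  | mem _ hx =>
    obtain ⟨c, l, m, hl, hm, rfl⟩ := hx
    exact h c l m hl hm
  | zero => simp
  | add _ _ _ _ hx hy => rw [map_add, map_add, hx, hy]
  | smul a _ _ hx => rw [map_smul, map_smul, hx]

variable (K V) in
/-- The involution as a linear map. -/
noncomputable def starLinear : LeavittPathAlgebra K V →ₗ[K] LeavittPathAlgebra K V where
  toFun := star
  map_add' := star_add
  map_smul' := star_smul_eq

theorem toWords_gen_mul {a b c : V} {l m : List (Edges V)} (g : Gen V) (hl : IsWalk a l c)
    (hm : IsWalk b m c) : toWords (mk (gen K g) * monomial K c l m) =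
      (ckSpace K V).mkQ (genAct K g (word K c l m)) := by
  rw [toWords_mul, toWords_monomial hl hm, wordRep_gen]

theorem trace_star (x : LeavittPathAlgebra K V) : trace (star x) = trace x := by
  suffices h : trace ∘ₗ starLinear K V = trace from LinearMap.congr_fun h x
  refine linearMap_ext_monomial ?_
  rintro c l m ⟨a, hl⟩ ⟨b, hm⟩
  change trace (star _) = _
  rw [star_monomial, trace_eq (toWords_monomial hl hm), trace_eq (toWords_monomial hm hl),
    diagRange_word, diagRange_word]
  by_cases h : l = m
  · subst h; rfl
  · rw [if_neg fun H => h H.1.symm, if_neg fun H => h H.1]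

theorem star_mk_gen (g : Gen V) : star (mk (gen K g)) = mk (gen K g.adjoint) := by
  cases g with
  | vertex a => exact star_vertex a
  | edge e => exact star_edge e
  | ghost e => exact star_ghost e

theorem trace_mul_comm (x y : LeavittPathAlgebra K V) : trace (x * y) = trace (y * x) := by
  induction x using induction_gen generalizing y with
  | gen g =>
    suffices h : trace ∘ₗ LinearMap.mulLeft K (mk (gen K g)) =
        trace ∘ₗ LinearMap.mulRight K (mk (gen K g)) from LinearMap.congr_fun h y
    refine linearMap_ext_monomial ?_
    rintro c l m ⟨a, hl⟩ ⟨b, hm⟩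
    simp only [LinearMap.comp_apply, LinearMap.mulLeft_apply, LinearMap.mulRight_apply]
    -- The action on words is from the left only, so the right multiplication is converted by the
    -- star-invariance of the trace.
    rw [← trace_star (monomial K c l m * _), star_mul, star_monomial, star_mk_gen,
      trace_eq (toWords_gen_mul g hl hm), trace_eq (toWords_gen_mul _ hm hl), diagRange_genAct]
  | add x x' hx hx' => rw [add_mul, mul_add, map_add, map_add, hx, hx']
  | smul c x hx => rw [smul_mul_assoc, mul_smul_comm, map_smul, map_smul, hx]
  | mul x x' hx hx' => rw [mul_assoc, hx, mul_assoc, hx', mul_assoc]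
  | zero => rw [zero_mul, mul_zero]

theorem trace_eq_zero_of_mem_commutators {x : LeavittPathAlgebra K V}
    (hx : x ∈ commutators K V) : trace x = 0 := by
  have : commutators K V ≤ LinearMap.ker (trace (K := K) (V := V)) := by
    refine Submodule.span_le.2 ?_
    rintro _ ⟨a, b, rfl⟩
    simp [trace_mul_comm a b]
  exact this hx

/-- The coordinates of an element with respect to the monomials in normal form. -/
noncomputable def normalCoords : LeavittPathAlgebra K V →ₗ[K] WordSpace K V :=
  (ckSpace K V).liftQ _ (ckSpace_le_ker_normalForm K) ∘ₗ toWords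

theorem normalCoords_eq {x : LeavittPathAlgebra K V} {w : WordSpace K V}
    (h : toWords x = (ckSpace K V).mkQ w) : normalCoords x = normalForm K V w := by
  rw [normalCoords, LinearMap.comp_apply, h]
  rfl

theorem mkQ_normalCoords (x : LeavittPathAlgebra K V) :
    (ckSpace K V).mkQ (normalCoords x) = toWords x := by
  obtain ⟨w, hw⟩ := (ckSpace K V).mkQ_surjective (toWords x)
  rw [normalCoords_eq hw.symm, mkQ_normalForm, hw]

theorem swapWord_normalCoords (x : LeavittPathAlgebra K V) :
    swapWord K V (normalCoords x) = normalCoords (star x) := by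
  suffices h : swapWord K V ∘ₗ normalCoords = normalCoords ∘ₗ starLinear K V from
    LinearMap.congr_fun h x
  refine linearMap_ext_monomial ?_
  rintro c l m ⟨a, hl⟩ ⟨b, hm⟩
  change swapWord K V (normalCoords _) = normalCoords (star _)
  rw [star_monomial, normalCoords_eq (toWords_monomial hl hm),
    normalCoords_eq (toWords_monomial hm hl), normalForm_word, normalForm_word,
    swapWord_normalRev]

theorem diagRange_normalCoords_mem {x : LeavittPathAlgebra K V} (hx : x ∈ commutators K V) :
    diagRange K V (normalCoords x) ∈ spanB K V := by
  rw [← Submodule.Quotient.mk_eq_zero, ← trace_eq_zero_of_mem_commutators hx,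
    trace_eq (mkQ_normalCoords x).symm]
  rfl

theorem sum_eraseNone {ι M : Type*} [AddCommMonoid M] (s : Finset (Option ι)) (f : Option ι → M)
    (h : f none = 0) : ∑ i ∈ s.eraseNone, f (some i) = ∑ i ∈ s, f i := by
  classical
  rw [← Finset.sum_erase s h, ← Finset.map_some_eraseNone, Finset.sum_map]
  rfl

theorem eq_sum_normalCoords (x : LeavittPathAlgebra K V) :
    x = ∑ i ∈ (normalCoords x).support.eraseNone,
      normalCoords x (some i) • monomial K i.1 i.2.1 i.2.2 := by
  have h : (evalWord K V (normalCoords x)).snd = x := by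
    have := evalQuot_toWords x
    rw [← mkQ_normalCoords x] at this
    exact congrArg (fun y => y.snd) this
  nth_rw 1 [← h]
  rw [snd_evalWord, Finsupp.sum, ← sum_eraseNone _ _ (by simp)]

open Classical in
theorem diagRange_eq_sum (w : WordSpace K V) : diagRange K V w =
    ∑ i ∈ w.support.eraseNone.filter (fun i => i.2.1 = i.2.2 ∧ ∃ a, IsWalk a i.2.1 i.1),
      w (some i) • Finsupp.single i.1 1 := by
  rw [diagRange, Finsupp.lsum_apply, Finsupp.sum, ← sum_eraseNone _ _ (by simp),
    Finset.sum_filter]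
  refine Finset.sum_congr rfl fun i _ => ?_
  rw [LinearMap.toSpanSingleton_apply, smul_ite, smul_zero]

/-! ### Membership in the commutator subspace -/

section Path

theorem pathAux_eq_walkElt {a b : V} (p : Quiver.Path a b) :
    pathAux K p = walkElt K b (edgeList p) := by
  induction p with
  | nil => rfl
  | cons p e ih =>
    rw [pathAux, ih, edgeList]
    exact (walkElt_concat (e := ⟨_, _, e⟩) rfl _).symm

theorem path_eq_walkElt (p : FinPath V) : path K p = walkElt K p.range (edgeList p.2.2) :=
  pathAux_eq_walkElt p.2.2

theorem path_mul_ghostPath {p q : FinPath V} (h : p.range = q.range) :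
    path K p * ghostPath K q = monomial K p.range (edgeList p.2.2) (edgeList q.2.2) := by
  rw [← star_path, path_eq_walkElt, path_eq_walkElt, monomial, h]

theorem path_mul_ghostPath_eq_zero {p q : FinPath V} (h : p.range ≠ q.range) :
    path K p * ghostPath K q = 0 := by
  rw [← star_path, path_eq_walkElt, path_eq_walkElt, ← walkElt_mul_vertex,
    ← walkElt_mul_vertex q.range, star_mul, star_vertex, ← mul_assoc, mul_assoc (walkElt K _ _),
    vertex_mul_vertex_ne h, mul_zero, zero_mul]

theorem ghostPath_mul_path (p : FinPath V) : ghostPath K p * path K p = vertex K p.range := by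
  obtain ⟨a, b, p⟩ := p
  change ghostAux K p * pathAux K p = vertex K b
  induction p with
  | nil => exact vertex_mul_vertex_same a
  | @cons b c p e ih =>
    rw [ghostAux, pathAux, mul_assoc, ← mul_assoc (ghostAux K p), ih]
    have := vertex_mul_edge (K := K) (⟨b, c, e⟩ : Edges V)
    rw [this]
    exact ghost_mul_edge_same _

theorem mul_sub_mul_mem_commutators (x y : LeavittPathAlgebra K V) :
    x * y - y * x ∈ commutators K V :=
  Submodule.subset_span ⟨x, y, rfl⟩

theorem path_mul_ghostPath_sub_vertex_mem (p : FinPath V) :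
    path K p * ghostPath K p - vertex K p.range ∈ commutators K V := by
  rw [← ghostPath_mul_path]
  exact mul_sub_mul_mem_commutators _ _

theorem monomial_mem_commutators (hE : NoCycle V) {c : V} {l m : List (Edges V)} (h : l ≠ m) :
    monomial K c l m ∈ commutators K V := by
  classical
  -- The only use of acyclicity: a nonempty path ending at `c` does not start at `c`. Commuting such
  -- a path or its ghost with the vertex `c` thus leaves a single term.
  have hzero : ∀ l : List (Edges V), l ≠ [] → vertex K c * walkElt K c l = 0 := fun l hl => by
    rw [vertex_mul_walkElt, if_neg fun H => hl (hE.eq_nil H)]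
  induction l generalizing m with
  | nil =>
    have hm : walkElt K c m * vertex K c = walkElt K c m := walkElt_mul_vertex c m
    have := mul_sub_mul_mem_commutators (vertex K c) (star (walkElt K c m))
    rwa [← star_vertex (K := K) c, ← star_mul (vertex K c), hzero m h.symm, star_zero, sub_zero,
      star_vertex] at this
  | cons e l ih =>
    cases m with
    | nil =>
      have := mul_sub_mul_mem_commutators (walkElt K c (e :: l)) (vertex K c)
      rwa [hzero _ h, sub_zero, ← star_vertex (K := K) c] at this
    | cons f m =>
      have hfac : monomial K c (e :: l) (f :: m) = edge K e * monomial K c l m * ghost K f := by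
        simp [monomial, walkElt_cons, star_edge, mul_assoc]
      rw [hfac]
      have hcomm := mul_sub_mul_mem_commutators (edge K e * monomial K c l m) (ghost K f)
      by_cases hef : e = f
      · subst hef
        -- Here `[e l m*, e*] = e l m* e* - r(e) l m*`; the last term is `l m*` or zero, and `l m*`
        -- is covered by induction.
        have hlm : l ≠ m := fun H => h (by rw [H])
        rw [← mul_assoc (ghost K e), ghost_mul_edge_same, monomial, ← mul_assoc (vertex K _), vertex_mul_walkElt] at hcomm
        split_ifs at hcomm with h'
        · exact (Submodule.sub_mem_iff_left _ (ih hlm)).1 hcomm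
        · rw [zero_mul, sub_zero] at hcomm
          exact hcomm
      · rwa [← mul_assoc (ghost K f), ghost_mul_edge_ne (Ne.symm hef), zero_mul, sub_zero] at hcomm

theorem path_mul_ghostPath_mem_commutators (hE : NoCycle V) {p q : FinPath V} (h : p ≠ q) :
    path K p * ghostPath K q ∈ commutators K V := by
  by_cases hr : p.range = q.range
  · rw [path_mul_ghostPath hr]
    refine monomial_mem_commutators hE fun H => h ?_
    exact edgeList_injective hr H
  · rw [path_mul_ghostPath_eq_zero hr]
    exact Submodule.zero_mem _

theorem sub_star_mem_commutators (hE : NoCycle V) (x : LeavittPathAlgebra K V) :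
    x - star x ∈ commutators K V := by
  induction mem_span_monomial x using Submodule.span_induction with
  | mem _ hx =>
    obtain ⟨c, l, m, -, -, rfl⟩ := hx
    rw [star_monomial]
    by_cases h : l = m
    · subst h
      simp
    · exact Submodule.sub_mem _ (monomial_mem_commutators hE h)
        (monomial_mem_commutators hE (Ne.symm h))
  | zero => simp
  | add x y _ _ hx hy =>
    rw [star_add, add_sub_add_comm]
    exact Submodule.add_mem _ hx hy
  | smul a x _ hx =>
    rw [star_smul_eq, ← smul_sub]
    exact Submodule.smul_mem _ _ hx

variable (K V) in
/-- The linear map `K^(E⁰) → L` that sends `ε_v` to `v`. -/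
noncomputable def vertexSum : (V →₀ K) →ₗ[K] LeavittPathAlgebra K V :=
  Finsupp.linearCombination K (vertex K)

/-- By (CK2) and (CK1), the image of `B_c` for regular `c` is the sum of `e* e - e e*` over the
edges from `c`. -/
theorem vertexSum_mem_commutators {y : V →₀ K} (hy : y ∈ spanB K V) :
    vertexSum K V y ∈ commutators K V := by
  suffices h : spanB K V ≤ (commutators K V).comap (vertexSum K V) from h hy
  refine Submodule.span_le.2 ?_
  rintro _ ⟨c, rfl⟩
  change vertexSum K V ((B c).mapRange _ _) ∈ commutators K V
  by_cases hc : IsRegular c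
  · rw [mapRange_B K hc, map_sub, map_sum]
    simp only [vertexSum, Finsupp.linearCombination_single, one_smul]
    rw [vertex_eq_sum hc, ← Finset.sum_sub_distrib]
    refine Submodule.sum_mem _ fun e _ => ?_
    rw [← ghost_mul_edge_same]
    exact mul_sub_mul_mem_commutators _ _
  · simp [B, hc]

end Path

/-! ### Characteristic 2: the two implications -/

section Main

theorem mem_of_combination (h2 : ringChar K = 2) (hE : NoCycle V) {k l : ℕ} (a : Fin k → K)
    (p : Fin k → FinPath V) (b : Fin l → K) (q t : Fin l → FinPath V)
    (ha : (∑ i, a i • Finsupp.single (p i).range (1 : K)) ∈ spanB K V) (hqt : ∀ i, t i ≠ q i) :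
    (∑ i, a i • (path K (p i) * ghostPath K (p i))) +
        ∑ i, b i • (path K (t i) * ghostPath K (q i) - path K (q i) * ghostPath K (t i)) ∈
      skewElements K V ∩ (commutators K V : Set (LeavittPathAlgebra K V)) := by
  have hstar : ∀ p q : FinPath V,
      star (path K p * ghostPath K q) = path K q * ghostPath K p := fun p q => by
    rw [← star_path, ← star_path, star_mul, star_star]
  constructor
  · have : CharP K 2 := ringChar.of_eq h2
    have hneg : ∀ x : LeavittPathAlgebra K V, -x = x := fun x => by
      rw [← neg_one_smul K x, CharTwo.neg_eq, one_smul]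
    change star _ = -_
    simp only [star_add, star_sum, star_smul_eq, star_sub, hstar, neg_add]
    congr 1
    · rw [hneg]
    · rw [← Finset.sum_neg_distrib]
      refine Finset.sum_congr rfl fun i _ => ?_
      rw [← smul_neg, neg_sub]
  · refine Submodule.add_mem _ ?_ (Submodule.sum_mem _ fun i _ => Submodule.smul_mem _ _ <|
      Submodule.sub_mem _ (path_mul_ghostPath_mem_commutators hE (hqt i))
        (path_mul_ghostPath_mem_commutators hE (hqt i).symm))
    have h := vertexSum_mem_commutators ha
    rw [map_sum] at h
    simp only [map_smul, vertexSum, Finsupp.linearCombination_single, one_smul] at h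
    -- Modulo commutators each `p p*` may be replaced by `r(p)`, and the resulting combination of
    -- vertices is the element in `h`.
    refine (Submodule.sub_mem_iff_left _ h).1 ?_
    rw [← Finset.sum_sub_distrib]
    refine Submodule.sum_mem _ fun i _ => ?_
    rw [← smul_sub]
    exact Submodule.smul_mem _ _ (path_mul_ghostPath_sub_vertex_mem (p i))

theorem sum_eq_sum_diag_add_sum_lt {ι α M : Type*} [DecidableEq α] [LinearOrder α]
    [AddCommMonoid M] (F : Finset (ι × α × α)) (hF : ∀ c l m, (c, l, m) ∈ F → (c, m, l) ∈ F)
    (f : ι × α × α → M) : ∑ i ∈ F, f i = ∑ i ∈ F.filter (fun i => i.2.1 = i.2.2), f i +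
      ∑ i ∈ F.filter (fun i => i.2.1 < i.2.2), (f i + f (i.1, i.2.2, i.2.1)) := by
  have hswap : ∑ i ∈ F.filter (fun i => i.2.1 < i.2.2), f (i.1, i.2.2, i.2.1) =
      ∑ i ∈ F.filter (fun i => i.2.2 < i.2.1), f i := by
    refine Finset.sum_bij' (fun i _ => (i.1, i.2.2, i.2.1)) (fun i _ => (i.1, i.2.2, i.2.1))
      ?_ ?_ (fun _ _ => rfl) (fun _ _ => rfl) (fun _ _ => rfl)
    · rintro ⟨c, l, m⟩ hi
      exact Finset.mem_filter.2 ((Finset.mem_filter.1 hi).imp_left (hF c l m))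
    · rintro ⟨c, l, m⟩ hi
      exact Finset.mem_filter.2 ((Finset.mem_filter.1 hi).imp_left (hF c l m))
  rw [Finset.sum_add_distrib, hswap,
    ← Finset.sum_filter_add_sum_filter_not F fun i => i.2.1 = i.2.2]
  congr 1
  rw [← Finset.sum_filter_add_sum_filter_not _ fun i => i.2.1 < i.2.2, Finset.filter_filter,
    Finset.filter_filter]
  congr 1
  · refine Finset.sum_congr (Finset.filter_congr fun i _ => ?_) fun _ _ => rfl
    exact ⟨fun h => h.2, fun h => ⟨h.ne, h⟩⟩
  · refine Finset.sum_congr (Finset.filter_congr fun i _ => ?_) fun _ _ => rfl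
    exact ⟨fun h => lt_of_le_of_ne (not_lt.1 h.2) (Ne.symm h.1), fun h => ⟨h.ne', h.le.not_gt⟩⟩

theorem exists_combination_of_mem (h2 : ringChar K = 2) {x : LeavittPathAlgebra K V}
    (hx : x ∈ skewElements K V) (hc : x ∈ commutators K V) :
    ∃ (k l : ℕ) (a : Fin k → K) (p : Fin k → FinPath V)
      (b : Fin l → K) (q t : Fin l → FinPath V),
      x = (∑ i, a i • (path K (p i) * ghostPath K (p i))) +
          ∑ i, b i • (path K (t i) * ghostPath K (q i) - path K (q i) * ghostPath K (t i)) ∧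
      (∑ i, a i • Finsupp.single (p i).range (1 : K)) ∈ spanB K V ∧ ∀ i, t i ≠ q i := by
  classical
  have : CharP K 2 := ringChar.of_eq h2
  have hneg : ∀ x : LeavittPathAlgebra K V, -x = x := fun x => by
    rw [← neg_one_smul K x, CharTwo.neg_eq, one_smul]
  have hstar : star x = x := Eq.trans hx (hneg x)
  have hswap : ∀ c l m, normalCoords x (some (c, l, m)) = normalCoords x (some (c, m, l)) :=
    fun c l m => by
      rw [← swapWord_apply, swapWord_normalCoords, hstar]
  -- An arbitrary linear order, used to select one word from each off-diagonal pair `(l, m)`, `(m,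
  -- l)`.
  let _ : LinearOrder (List (Edges V)) := linearOrderOfSTO WellOrderingRel
  set w := normalCoords x with hw
  -- Restricting to pairs of genuine paths loses nothing, since the other monomials vanish; it
  -- allows the lists to be lifted to paths.
  let F : Finset (Word V) := w.support.eraseNone.filter
    fun i => (∃ a, IsWalk a i.2.1 i.1) ∧ ∃ a, IsWalk a i.2.2 i.1
  have hF : ∀ i, i ∈ F ↔ w (some i) ≠ 0 ∧ (∃ a, IsWalk a i.2.1 i.1) ∧ ∃ a, IsWalk a i.2.2 i.1 :=
    fun i => by simp [F]
  have hFswap : ∀ c l m, (c, l, m) ∈ F → (c, m, l) ∈ F := fun c l m h => by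
    obtain ⟨h₀, h₁, h₂⟩ := (hF _).1 h
    exact (hF _).2 ⟨by rwa [hswap c m l], h₂, h₁⟩
  let D := F.filter fun i => i.2.1 = i.2.2
  let O := F.filter fun i => i.2.1 < i.2.2
  have hpath : ∀ (c : V) (l : List (Edges V)), (∃ a, IsWalk a l c) →
      ∃ p : FinPath V, p.range = c ∧ edgeList p.2.2 = l := by
    rintro c l ⟨a, h⟩
    obtain ⟨p, hp⟩ := exists_edgeList_eq h
    exact ⟨⟨a, c, p⟩, rfl, hp⟩
  have hl : ∀ i : F, ∃ p : FinPath V, p.range = i.1.1 ∧ edgeList p.2.2 = i.1.2.1 := fun i =>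
    hpath _ _ ((hF _).1 i.2).2.1
  have hm : ∀ i : F, ∃ p : FinPath V, p.range = i.1.1 ∧ edgeList p.2.2 = i.1.2.2 := fun i =>
    hpath _ _ ((hF _).1 i.2).2.2
  choose pl hpl using hl
  choose pm hpm using hm
  have hD : ∀ i, i ∈ D → i ∈ F := fun i hi => (Finset.mem_filter.1 hi).1
  have hO : ∀ i, i ∈ O → i ∈ F := fun i hi => (Finset.mem_filter.1 hi).1
  let eD := D.equivFin.symm
  let eO := O.equivFin.symm
  refine ⟨D.card, O.card, fun i => w (some (eD i).1), fun i => pl ⟨(eD i).1, hD _ (eD i).2⟩,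
    fun i => w (some (eO i).1), fun i => pm ⟨(eO i).1, hO _ (eO i).2⟩,
    fun i => pl ⟨(eO i).1, hO _ (eO i).2⟩, ?_, ?_, ?_⟩
  · rw [Equiv.sum_comp eD fun i : D => w (some i.1) • (path K (pl ⟨i.1, hD _ i.2⟩) *
        ghostPath K (pl ⟨i.1, hD _ i.2⟩)),
      Equiv.sum_comp eO fun i : O => w (some i.1) • (path K (pl ⟨i.1, hO _ i.2⟩) *
        ghostPath K (pm ⟨i.1, hO _ i.2⟩) - path K (pm ⟨i.1, hO _ i.2⟩) *
        ghostPath K (pl ⟨i.1, hO _ i.2⟩))]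
    have hDsum : ∀ i : D, w (some i.1) • (path K (pl ⟨i.1, hD _ i.2⟩) *
        ghostPath K (pl ⟨i.1, hD _ i.2⟩)) =
          w (some i.1) • monomial K i.1.1 i.1.2.1 i.1.2.2 := fun i => by
      rw [path_mul_ghostPath rfl, (hpl _).1, (hpl _).2, (Finset.mem_filter.1 i.2).2]
    have hOsum : ∀ i : O, w (some i.1) • (path K (pl ⟨i.1, hO _ i.2⟩) *
        ghostPath K (pm ⟨i.1, hO _ i.2⟩) - path K (pm ⟨i.1, hO _ i.2⟩) *
        ghostPath K (pl ⟨i.1, hO _ i.2⟩)) =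
          w (some i.1) • monomial K i.1.1 i.1.2.1 i.1.2.2 +
          w (some i.1) • monomial K i.1.1 i.1.2.2 i.1.2.1 := fun i => by
      rw [path_mul_ghostPath ((hpl _).1.trans (hpm _).1.symm),
        path_mul_ghostPath ((hpm _).1.trans (hpl _).1.symm), (hpl _).1, (hpl _).2, (hpm _).1,
        (hpm _).2, sub_eq_add_neg, hneg, smul_add]
    rw [Finset.sum_congr rfl fun i _ => hDsum i, Finset.sum_congr rfl fun i _ => hOsum i,
      Finset.sum_coe_sort D fun i => w (some i) • monomial K i.1 i.2.1 i.2.2,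
      Finset.sum_coe_sort O fun i => w (some i) • monomial K i.1 i.2.1 i.2.2 +
        w (some i) • monomial K i.1 i.2.2 i.2.1]
    have hxF : x = ∑ i ∈ F, w (some i) • monomial K i.1 i.2.1 i.2.2 := by
      refine (eq_sum_normalCoords x).trans (Finset.sum_filter_of_ne fun i _ hi => ?_).symm
      by_contra H
      exact hi (by rw [monomial_eq_zero H, smul_zero])
    rw [hxF, sum_eq_sum_diag_add_sum_lt F hFswap fun i => w (some i) • monomial K i.1 i.2.1 i.2.2]
    refine congrArg _ (Finset.sum_congr rfl fun i _ => ?_)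
    rw [hswap i.1 i.2.1]
  · rw [Equiv.sum_comp eD fun i : D =>
      w (some i.1) • Finsupp.single (pl ⟨i.1, hD _ i.2⟩).range (1 : K)]
    have hsum : ∀ i : D, w (some i.1) • Finsupp.single (pl ⟨i.1, hD _ i.2⟩).range (1 : K) =
        w (some i.1) • Finsupp.single i.1.1 1 := fun i => by rw [(hpl _).1]
    rw [Finset.sum_congr rfl fun i _ => hsum i,
      Finset.sum_coe_sort D fun i => w (some i) • Finsupp.single i.1 (1 : K)]
    -- The diagonal coefficients sum to a representative of the trace of `x`, which is zero because
    -- `x` lies in `[L, L]`.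
    have hmem := diagRange_normalCoords_mem hc
    rw [← hw, diagRange_eq_sum] at hmem
    convert hmem using 2
    ext ⟨c, l, m⟩
    simp only [D, F, Finset.mem_filter]
    constructor
    · rintro ⟨⟨h, h₁, -⟩, h₂⟩
      exact ⟨h, h₂, h₁⟩
    · rintro ⟨h, rfl, h₁⟩
      exact ⟨⟨h, h₁, h₁⟩, rfl⟩
  · intro i h
    have h₁ := (Finset.mem_filter.1 (eO i).2).2
    rw [← (hpl ⟨(eO i).1, hO _ (eO i).2⟩).2, ← (hpm ⟨(eO i).1, hO _ (eO i).2⟩).2] at h₁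
    exact h₁.ne (congrArg (fun p : FinPath V => edgeList p.2.2) h)

end Main

end LeavittPathAlgebra

theorem corollary3p7 (K : Type v) [Field K] (V : Type u) [Quiver.{w} V]
    (hE : Leavitt.NoCycle V) :
    (ringChar K ≠ 2 →
      LeavittPathAlgebra.skewElements K V ∩
          (LeavittPathAlgebra.commutators K V : Set (LeavittPathAlgebra K V)) =
        LeavittPathAlgebra.skewElements K V) ∧
    (ringChar K = 2 →
      ∀ x : LeavittPathAlgebra K V,
        x ∈ LeavittPathAlgebra.skewElements K V ∩
            (LeavittPathAlgebra.commutators K V : Set (LeavittPathAlgebra K V)) ↔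
          ∃ (k l : ℕ) (a : Fin k → K) (p : Fin k → Leavitt.FinPath V)
            (b : Fin l → K) (q t : Fin l → Leavitt.FinPath V),
            x = (∑ i, a i • (LeavittPathAlgebra.path K (p i) *
                  LeavittPathAlgebra.ghostPath K (p i))) +
                ∑ i, b i • (LeavittPathAlgebra.path K (t i) *
                    LeavittPathAlgebra.ghostPath K (q i) -
                  LeavittPathAlgebra.path K (q i) * LeavittPathAlgebra.ghostPath K (t i)) ∧
            (∑ i, a i • Finsupp.single (p i).range (1 : K)) ∈ Leavitt.spanB K V ∧
            ∀ i, t i ≠ q i) := by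
  refine ⟨fun h2 => Set.inter_eq_left.2 fun x hx => ?_, fun h2 x => ⟨fun hx => ?_, ?_⟩⟩
  · have hx : star x = -x := hx
    have h := LeavittPathAlgebra.sub_star_mem_commutators hE x
    rw [hx, sub_neg_eq_add, ← two_smul K] at h
    exact (Submodule.smul_mem_iff _ (Ring.two_ne_zero h2)).1 h
  · exact LeavittPathAlgebra.exists_combination_of_mem h2 hx.1 hx.2
  · rintro ⟨k, l, a, p, b, q, t, rfl, ha, hqt⟩
    exact LeavittPathAlgebra.mem_of_combination h2 hE a p b q t ha hqt
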